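/- Let $(\mathcal A;\mathcal E)$ be an exact category: $\mathcal A$ is additive and $\mathcal E$ is an isomorphism-closed class of kernel-cokernel pairs (conflations $A\to B\to C$, consisting of an inflation and a deflation) such that identities are inflations and deflations, inflations and deflations are closed under composition, and pushouts of inflations and pullbacks of deflations along arbitrary morphisms exist and are again inflations, respectively deflations. Assume that for all objects $C,A$ the isomorphism classes of conflations $A\to B\to C$ form a set $\operatorname{Ext}(C,A)$. For morphisms $m\colon Y\to C$ and $f\colon A\to X$, $\operatorname{Ext}(m,f)\colon \operatorname{Ext}(C,A)\to\operatorname{Ext}(Y,X)$ is pullback along $m$ followed by pushout along $f$, and $0$ stands for the split conflations. *Notation.* An ideal is a class of morphisms that is a subgroup of each Hom group and closed under composition with arbitrary morphisms on both sides. For a class $\mathcal M$ of morphisms, ${}^\perp\mathcal M=\{m\mid \operatorname{Ext}(m,f)=0\ \forall f\in\mathcal M\}$ and $\mathcal M^\perp=\{f\mid\operatorname{Ext}(m,f)=0\ \forall m\in\mathcal M\}$; $\operatorname{Ob}(\mathcal I)=\{X\mid 1_X\in\mathcal I\}$; an ideal $\mathcal I$ is an object ideal if it consists of the morphisms that factor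 through an object of $\operatorname{Ob}(\mathcal I)$. For an ordinal $\mu$, a $\mu$-system is a functor $\mathsf A\colon\mu\to\mathcal A$, with structural morphisms $A_\alpha\to A_\beta$ ($\alpha\le\beta<\mu$); it is continuous if $A_\beta=\varinjlim_{\alpha<\beta}A_\alpha$ for every limit ordinal $\beta<\mu$. A $\lambda$-composition of morphisms in a class $\mathcal J$ is the morphism $A_0\to A_\lambda$ of a continuous $(\lambda+1)$-system with all $A_\alpha\to A_{\alpha+1}$ ($\alpha<\lambda$) in $\mathcal J$; the inductive power $\mathcal J^{(\lambda)}$ is the ideal generated by all $\lambda$-compositions of morphisms in $\mathcal J$. For a class $\mathcal C$ of objects, $\lambda\text{-}\mathrm{Filt}(\mathcal C)$ consists of the objects $A_\lambda$ for continuous $(\lambda+1)$-systems with $A_0=0$ in which all $A_\alpha\to A_{\alpha+1}$ are inflations with cokernel in $\mathcal C$. For a set $\mathcal S$ of objects, $\mathfrak g_{\mathcal S}=\{f\mid \operatorname{Ext}(S,f)=0\ \forall S\in\mathcal S\}$, and $\mathrm{Sum}(\mathcal S)$ is the class of all coproducts, indexed by sets (possibly empty), of objects of $\mathcal S$. $\mathcal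 E\text{-}\mathrm{Proj}$ is the class of objects $P$ with $\operatorname{Ext}(P,-)=0$; there are enough projectives if each object is the target of a deflation from a projective object. $\mathcal B\star\mathcal C$ is the class of objects $X$ in a conflation $B\to X\to C$ with $B\in\mathcal B$, $C\in\mathcal C$, and $\mathrm{add}(\mathcal C)$ is the class of direct summands of finite direct sums of objects of $\mathcal C$. An ideal $\mathcal J$ is object-special preenveloping if each object $A$ has a conflation $A\xrightarrow{j}B\to W$ with $j\in\mathcal J$ and $W\in\operatorname{Ob}({}^\perp\mathcal J)$ (such a $W$ is a $\mathcal J$-cosyzygy of $A$). A class of objects of ${}^\perp\mathcal J$ that is closed under finite direct sums and contains a $\mathcal J$-cosyzygy of each object is a $\mathcal J$-cosyzygy subcategory. A pair of ideals $(\mathcal I,\mathcal J)$ is an ideal cotorsion pair if $\mathcal I^\perp=\mathcal J$ and $\mathcal I={}^\perp\mathcal J$. It is complete if every object is the target of a deflation in $\mathcal I$ that arises from some conflation by pushout along a morphism in $\mathcal I^\perp$, and every object is the source of an inflation in $\mathcal J$ that arises from some conflation by pullback along a morphism in ${}^\perp\mathcal J$. **Corollary.** Let $\mathcal S$ be a set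 of objects of $\mathcal A$ and $\lambda$ an infinite ordinal. Suppose that 1. $\mathcal A$ has exact coproducts: all coproducts indexed by sets exist, and coproducts of conflations are conflations; 2. for every ordinal $0<\beta\le\lambda$, every continuous $\beta$-system $\mathsf A$ in $\mathcal A$ such that $A_\alpha\to A_{\alpha+1}$ is an inflation whenever $\alpha+1<\beta$ has a colimit, and $A_0\to\varinjlim_{\alpha<\beta}A_\alpha$ is an inflation. Then $\mathfrak g_{\mathcal S}^{(\lambda)}$ is an object-special preenveloping ideal, and $\lambda\text{-}\mathrm{Filt}(\mathrm{Sum}(\mathcal S))$ is a $\mathfrak g_{\mathcal S}^{(\lambda)}$-cosyzygy subcategory. If moreover $\mathcal A$ has enough projectives, then $({}^\perp(\mathfrak g_{\mathcal S}^{(\lambda)}),\mathfrak g_{\mathcal S}^{(\lambda)})$ is a complete ideal cotorsion pair, ${}^\perp(\mathfrak g_{\mathcal S}^{(\lambda)})$ is an object ideal, and $$\operatorname{Ob}\bigl({}^\perp(\mathfrak g_{\mathcal S}^{(\lambda)})\bigr)=\mathrm{add}\bigl(\mathcal E\text{-}\mathrm{Proj}\star\lambda\text{-}\mathrm{Filt}(\mathrm{Sum}(\mathcal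 S))\bigr).$$ -/

import Mathlib

open CategoryTheory CategoryTheory.Limits

universe w v u

attribute [local instance] hasBinaryBiproducts_of_finite_biproducts

/-- An exact structure on an additive category: an isomorphism-closed class of kernel-cokernel
pairs (the conflations `A ⟶ B ⟶ C`) such that identities are inflations and deflations,
inflations and deflations compose, inflations have pushouts along arbitrary morphisms which are
again inflations, and deflations have pullbacks along arbitrary morphisms which are again
deflations. -/
structure ExactStructure (C : Type u) [Category.{v} C] [Preadditive C] where
  /-- the class of conflations -/
  conflation : ShortComplex C → Prop
  conflation_of_iso : ∀ {S T : ShortComplex C}, (S ≅ T) → conflation S → conflation T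
  isKernel : ∀ {S : ShortComplex C}, conflation S → Nonempty (IsLimit (KernelFork.ofι S.f S.zero))
  isCokernel : ∀ {S : ShortComplex C}, conflation S →
    Nonempty (IsColimit (CokernelCofork.ofπ S.g S.zero))
  id_inflation : ∀ A : C, ∃ (X : C) (p : A ⟶ X) (h : 𝟙 A ≫ p = 0),
    conflation (ShortComplex.mk (𝟙 A) p h)
  id_deflation : ∀ A : C, ∃ (X : C) (i : X ⟶ A) (h : i ≫ 𝟙 A = 0),
    conflation (ShortComplex.mk i (𝟙 A) h)
  comp_inflation : ∀ {A B D : C} (i : A ⟶ B) (j : B ⟶ D),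
    (∃ (X : C) (p : B ⟶ X) (h : i ≫ p = 0), conflation (ShortComplex.mk i p h)) →
    (∃ (X : C) (p : D ⟶ X) (h : j ≫ p = 0), conflation (ShortComplex.mk j p h)) →
    ∃ (X : C) (p : D ⟶ X) (h : (i ≫ j) ≫ p = 0), conflation (ShortComplex.mk (i ≫ j) p h)
  comp_deflation : ∀ {A B D : C} (p : A ⟶ B) (q : B ⟶ D),
    (∃ (X : C) (i : X ⟶ A) (h : i ≫ p = 0), conflation (ShortComplex.mk i p h)) →
    (∃ (X : C) (i : X ⟶ B) (h : i ≫ q = 0), conflation (ShortComplex.mk i q h)) →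
    ∃ (X : C) (i : X ⟶ A) (h : i ≫ p ≫ q = 0), conflation (ShortComplex.mk i (p ≫ q) h)
  pushout_inflation : ∀ {A B A' : C} (i : A ⟶ B) (f : A ⟶ A'),
    (∃ (X : C) (p : B ⟶ X) (h : i ≫ p = 0), conflation (ShortComplex.mk i p h)) →
    ∃ (B' : C) (f' : B ⟶ B') (i' : A' ⟶ B'), IsPushout i f f' i' ∧
      ∃ (X : C) (p : B' ⟶ X) (h : i' ≫ p = 0), conflation (ShortComplex.mk i' p h)
  pullback_deflation : ∀ {B D D' : C} (p : B ⟶ D) (f : D' ⟶ D),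
    (∃ (X : C) (i : X ⟶ B) (h : i ≫ p = 0), conflation (ShortComplex.mk i p h)) →
    ∃ (B' : C) (f' : B' ⟶ B) (p' : B' ⟶ D'), IsPullback f' p' p f ∧
      ∃ (X : C) (i : X ⟶ B') (h : i ≫ p' = 0), conflation (ShortComplex.mk i p' h)

/-- A class of morphisms of a preadditive category is an ideal if it is an additive subgroup in
every hom-group and is closed under composition with arbitrary morphisms on both sides. -/
structure IsMorphismIdeal {C : Type u} [Category.{v} C] [Preadditive C]
    (I : MorphismProperty C) : Prop where
  zero_mem : ∀ X Y : C, I (0 : X ⟶ Y)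
  sub_mem : ∀ {X Y : C} (f g : X ⟶ Y), I f → I g → I (f - g)
  comp_mem : ∀ {A X Y B : C} (f : A ⟶ X) (g : X ⟶ Y) (h : Y ⟶ B), I g → I (f ≫ g ≫ h)

/-- The objects of a class `I` of morphisms: those whose identity lies in `I`. -/
def idealOb {C : Type u} [Category.{v} C] (I : MorphismProperty C) : ObjectProperty C :=
  fun X => I (𝟙 X)

/-- The class `⟨P⟩` of morphisms that factor through an object with property `P`. -/
def factorsThroughOb {C : Type u} [Category.{v} C] (P : ObjectProperty C) : MorphismProperty C :=
  fun X Y f => ∃ (Z : C) (g : X ⟶ Z) (h : Z ⟶ Y), P Z ∧ g ≫ h = f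

/-- `I` is an object ideal: an ideal with `I = ⟨Ob I⟩`. -/
def IsObjectIdeal {C : Type u} [Category.{v} C] [Preadditive C] (I : MorphismProperty C) : Prop :=
  IsMorphismIdeal I ∧ I = factorsThroughOb (idealOb I)

/-- For a well-ordered system `F`, the successive structural morphisms
`F α ⟶ F (α + 1)` all lie in `W`; here `α ⋖ β` says that `β` is the successor of `α`. -/
def SuccessiveMapsIn {C : Type u} [Category.{v} C] {J : Type*} [Preorder J] (F : J ⥤ C)
    (W : MorphismProperty C) : Prop :=
  ∀ (α β : J) (h : α ⋖ β), W (F.map (homOfLE h.le))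

/-- The first index `0` of an `(o + 1)`-system. -/
def firstIndex (o : Ordinal.{w}) : Set.Iic o := ⟨0, Set.mem_Iic.2 zero_le⟩

/-- The last index `o` of an `(o + 1)`-system. -/
def lastIndex (o : Ordinal.{w}) : Set.Iic o := ⟨o, Set.mem_Iic.2 le_rfl⟩

theorem firstIndex_le_lastIndex (o : Ordinal.{w}) : firstIndex o ≤ lastIndex o :=
  (zero_le : (0 : Ordinal.{w}) ≤ o)

/-- The `o`-compositions of morphisms in `W`: morphisms isomorphic to `F 0 ⟶ F o` for a continuous
`(o + 1)`-system `F` (indexed by the ordinals `≤ o`) whose successive structural morphisms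
lie in `W`. -/
def transfiniteComposition {C : Type u} [Category.{v} C] (W : MorphismProperty C)
    (o : Ordinal.{w}) : MorphismProperty C :=
  fun X Y f => ∃ (F : Set.Iic o ⥤ C) (e₀ : X ≅ F.obj (firstIndex o)) (e₁ : F.obj (lastIndex o) ≅ Y),
    F.IsWellOrderContinuous ∧ SuccessiveMapsIn F W ∧
    f = e₀.hom ≫ F.map (homOfLE (firstIndex_le_lastIndex o)) ≫ e₁.hom

/-- The `o`-th inductive power `W^(o)`: the ideal generated by all `o`-compositions
of morphisms in `W`. -/
def inductivePower {C : Type u} [Category.{v} C] [Preadditive C] (W : MorphismProperty C)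
    (o : Ordinal.{w}) : MorphismProperty C :=
  fun _ _ f => ∀ I : MorphismProperty C, IsMorphismIdeal I → transfiniteComposition W o ≤ I → I f

/-- `Sum(S)`: all coproducts of families, indexed by a set, of objects in `S` (including the
empty coproduct). -/
def sumClass {C : Type u} [Category.{v} C] (S : Set C) : ObjectProperty C :=
  fun X => ∃ (ι : Type v) (f : ι → C) (inj : ∀ i, f i ⟶ X),
    (∀ i, f i ∈ S) ∧ Nonempty (IsColimit (Cofan.mk X inj))

/-- `add(P)`: the direct summands of finite direct sums of objects in `P`. -/
def addClass {C : Type u} [Category.{v} C] [Preadditive C] [HasFiniteBiproducts C]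
    (P : ObjectProperty C) : ObjectProperty C :=
  fun X => ∃ (n : ℕ) (f : Fin n → C) (Z : C), (∀ i, P (f i)) ∧ Nonempty ((⨁ f) ≅ X ⊞ Z)

namespace ExactStructure

variable {C : Type u} [Category.{v} C] [Preadditive C] (E : ExactStructure C)

/-- The inflations of an exact structure. -/
def inflation : MorphismProperty C :=
  fun _ B i => ∃ (X : C) (p : B ⟶ X) (h : i ≫ p = 0), E.conflation (ShortComplex.mk i p h)

/-- The conflations `A ⟶ mid ⟶ X` with prescribed ends. -/
structure Extension (X A : C) where
  /-- the middle term -/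
  mid : C
  /-- the inflation -/
  i : A ⟶ mid
  /-- the deflation -/
  p : mid ⟶ X
  zero : i ≫ p = 0
  conflation : E.conflation (ShortComplex.mk i p zero)

variable {E}

/-- Isomorphism of conflations with fixed ends. -/
def Extension.Equivalent {X A : C} (ξ η : E.Extension X A) : Prop :=
  ∃ e : ξ.mid ≅ η.mid, ξ.i ≫ e.hom = η.i ∧ e.hom ≫ η.p = ξ.p

/-- A trivial conflation: the inflation is a section. -/
def Extension.IsTrivial {X A : C} (ξ : E.Extension X A) : Prop :=
  ∃ r : ξ.mid ⟶ A, ξ.i ≫ r = 𝟙 A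

/-- `η` is a pushout of `ξ` along `f : A ⟶ A'`. -/
def Extension.IsPushoutAlong {X A A' : C} (f : A ⟶ A') (ξ : E.Extension X A)
    (η : E.Extension X A') : Prop :=
  ∃ b : ξ.mid ⟶ η.mid, IsPushout ξ.i f b η.i ∧ b ≫ η.p = ξ.p

/-- `η` is a pullback of `ξ` along `m : Y ⟶ X`. -/
def Extension.IsPullbackAlong {X Y A : C} (m : Y ⟶ X) (ξ : E.Extension X A)
    (η : E.Extension Y A) : Prop :=
  ∃ b : η.mid ⟶ ξ.mid, IsPullback b η.p ξ.p m ∧ η.i ≫ b = ξ.i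

variable (E)

instance extensionSetoid (X A : C) : Setoid (E.Extension X A) where
  r := Extension.Equivalent
  iseqv :=
    { refl := fun ξ => ⟨Iso.refl _, by simp, by simp⟩
      symm := by
        rintro ξ η ⟨e, h₁, h₂⟩
        exact ⟨e.symm, by simp [← h₁], by simp [← h₂]⟩
      trans := by
        rintro ξ η ζ ⟨e, h₁, h₂⟩ ⟨e', h₁', h₂'⟩
        refine ⟨e ≪≫ e', ?_, ?_⟩
        · simp [← h₁', ← h₁]
        · simp [h₂', h₂] }

/-- `Ext(X, A)`: isomorphism classes of conflations `A ⟶ ? ⟶ X`. -/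
def Ext (X A : C) : Type (max u v) := Quotient (E.extensionSetoid X A)

/-- `Ext(X, f) = 0`: the pushout along `f` of every conflation `A ⟶ ? ⟶ X` is trivial. -/
def ExtObjMapZero (X : C) {A A' : C} (f : A ⟶ A') : Prop :=
  ∀ (ξ : E.Extension X A) (η : E.Extension X A'), ξ.IsPushoutAlong f η → η.IsTrivial

/-- `Ext(m, f) = 0` for `m : Y ⟶ X` and `f : A ⟶ A'`: for every conflation `A ⟶ ? ⟶ X`, its
pullback along `m`, pushed out along `f`, is trivial. -/
def ExtMapZero {X Y A A' : C} (m : Y ⟶ X) (f : A ⟶ A') : Prop :=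
  ∀ (ξ : E.Extension X A) (η : E.Extension Y A) (ζ : E.Extension Y A'),
    ξ.IsPullbackAlong m η → η.IsPushoutAlong f ζ → ζ.IsTrivial

/-- `⊥M`: the morphisms `m` with `Ext(m, f) = 0` for all `f` in `M`. -/
def leftPerp (M : MorphismProperty C) : MorphismProperty C :=
  fun _ _ m => ∀ ⦃A A' : C⦄ (f : A ⟶ A'), M f → E.ExtMapZero m f

/-- `M⊥`: the morphisms `f` with `Ext(m, f) = 0` for all `m` in `M`. -/
def rightPerp (M : MorphismProperty C) : MorphismProperty C :=
  fun _ _ f => ∀ ⦃Y X : C⦄ (m : Y ⟶ X), M m → E.ExtMapZero m f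

/-- The class `g_S` of `S`-ghost morphisms: `Ext(X, f) = 0` for all `X` in `S`. -/
def ghost (S : Set C) : MorphismProperty C :=
  fun _ _ f => ∀ X ∈ S, E.ExtObjMapZero X f

/-- The projective objects: every conflation ending in `P` is trivial. -/
def projectives : ObjectProperty C :=
  fun P => ∀ (A : C) (ξ : E.Extension P A), ξ.IsTrivial

/-- Every object `X` admits a conflation `A ⟶ P ⟶ X` with `P` projective. -/
def EnoughProjectives : Prop :=
  ∀ X : C, ∃ (A : C) (ξ : E.Extension X A), E.projectives ξ.mid

/-- `P ⋆ Q`: the objects `X` that fit into a conflation `B ⟶ X ⟶ D` with `B` in `P` and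
`D` in `Q`. -/
def star (P Q : ObjectProperty C) : ObjectProperty C :=
  fun X => ∃ (B D : C) (i : B ⟶ X) (p : X ⟶ D) (h : i ≫ p = 0),
    P B ∧ Q D ∧ E.conflation (ShortComplex.mk i p h)

/-- `o-Filt(P)`: the objects `X` with a continuous `(o + 1)`-system from `F 0 = 0` to `F o = X`
whose successive structural morphisms are inflations with cokernels in `P`. -/
def filt (o : Ordinal.{w}) (P : ObjectProperty C) : ObjectProperty C :=
  fun X => ∃ F : Set.Iic o ⥤ C, F.IsWellOrderContinuous ∧ IsZero (F.obj (firstIndex o)) ∧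
    Nonempty (F.obj (lastIndex o) ≅ X) ∧
    SuccessiveMapsIn F (fun _ B i => ∃ (Q : C) (p : B ⟶ Q) (h : i ≫ p = 0),
      P Q ∧ E.conflation (ShortComplex.mk i p h))

/-- Every continuous `o`-system (indexed by the ordinals `< o`, with `o > 0`) whose successive
structural morphisms are inflations has a colimit, and its composition morphism
`F 0 ⟶ colim F` is an inflation. -/
def InflationsCompose (o : Ordinal.{w}) (ho : 0 < o) : Prop :=
  ∀ F : Set.Iio o ⥤ C, F.IsWellOrderContinuous → SuccessiveMapsIn F E.inflation →
    ∃ c : Cocone F, Nonempty (IsColimit c) ∧ E.inflation (c.ι.app ⟨0, ho⟩)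

/-- Exact coproducts: all coproducts indexed by sets exist and coproducts of conflations
are conflations. -/
def HasExactCoproducts : Prop :=
  ∃ _ : HasCoproducts.{v} C, ∀ (ι : Type v) (S : ι → ShortComplex C),
    (∀ i, E.conflation (S i)) →
      E.conflation (ShortComplex.mk (Limits.Sigma.map fun i => (S i).f)
        (Limits.Sigma.map fun i => (S i).g) (by
          ext i
          simp))

/-- `J` is an object-special preenveloping ideal: every object `A` has a conflation
`A ⟶ B ⟶ W` whose inflation lies in `J` and with `W` an object of `⊥J`. -/
def IsObjectSpecialPreenveloping (J : MorphismProperty C) : Prop :=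
  IsMorphismIdeal J ∧ ∀ A : C, ∃ (W : C) (ξ : E.Extension W A),
    J ξ.i ∧ idealOb (E.leftPerp J) W

/-- `P` is a `J`-cosyzygy subcategory: it consists of objects of `⊥J`, is closed under finite
direct sums (including the empty one), and contains a `J`-cosyzygy of every object. -/
structure IsCosyzygySubcategory [HasFiniteBiproducts C] (J : MorphismProperty C)
    (P : ObjectProperty C) : Prop where
  le_perp : P ≤ idealOb (E.leftPerp J)
  of_isZero : ∀ Z : C, IsZero Z → P Z
  biprod : ∀ X Y : C, P X → P Y → P (X ⊞ Y)
  exists_cosyzygy : ∀ A : C, ∃ (W : C) (ξ : E.Extension W A), J ξ.i ∧ P W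

/-- An ideal cotorsion pair. -/
structure IsIdealCotorsionPair (I J : MorphismProperty C) : Prop where
  isIdeal_left : IsMorphismIdeal I
  isIdeal_right : IsMorphismIdeal J
  rightPerp_eq : E.rightPerp I = J
  leftPerp_eq : I = E.leftPerp J

/-- `I` is special precovering: every object `X` is the target of a deflation in `I` that is
the deflation of a pushout of some conflation along a morphism in `I⊥`. -/
def IsSpecialPrecovering (I : MorphismProperty C) : Prop :=
  ∀ X : C, ∃ (A A' : C) (j : A ⟶ A') (ξ : E.Extension X A) (η : E.Extension X A'),
    E.rightPerp I j ∧ ξ.IsPushoutAlong j η ∧ I η.p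

/-- `J` is special preenveloping: every object `A` is the source of an inflation in `J` that is
the inflation of a pullback of some conflation along a morphism in `⊥J`. -/
def IsSpecialPreenveloping (J : MorphismProperty C) : Prop :=
  ∀ A : C, ∃ (X Y : C) (m : Y ⟶ X) (ξ : E.Extension X A) (η : E.Extension Y A),
    E.leftPerp J m ∧ ξ.IsPullbackAlong m η ∧ J η.i

/-- A complete ideal cotorsion pair. -/
structure IsCompleteIdealCotorsionPair (I J : MorphismProperty C) : Prop where
  isIdealCotorsionPair : E.IsIdealCotorsionPair I J
  isSpecialPrecovering : E.IsSpecialPrecovering I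
  isSpecialPreenveloping : E.IsSpecialPreenveloping J

end ExactStructure

/-! Write `J` for the λ-th inductive power of the ghost ideal. Everything follows from two facts:
each object has a `J`-cosyzygy filtered by `Sum(S)`, and every object so filtered lies in `Ob(⊥J)`.

Cosyzygies. Pushing out the coproduct of all conflations from `A` to objects of `S` along the
codiagonal makes every one of them absorb into a single inflation out of `A`. That inflation is a
ghost with cokernel in `Sum(S)` (`exists_ghost_conflation`). Iterating along the ordinals up to λ
gives a λ-composition of ghosts (`exists_transfinite_iteration`), and dividing the chain by its
first term filters the cokernel (`exists_quotient_system`). Only chains of inflations are known to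
have colimits, so the recursion runs in a cocomplete category containing the given one, and the
result is shown to stay inside.

Orthogonality. This is an Eklof lemma (`exists_extension_of_filtration`). A conflation ending in a
filtered object pulls back along the filtration to a continuous chain of inflations starting at its
kernel. A morphism from the kernel to the start of a chain of ghosts then extends term by term: each
successor step of the filtration is paid for by one ghost, so the two chains need the same length.
Passing from λ-compositions to the ideal they generate is free, because right orthogonals are
ideals.

With enough projectives, Salce's argument finishes. Pushing out `K ⟶ P ⟶ X` along a cosyzygy
inflation of `K` gives a deflation onto `X` from an object of `Proj ⋆ Filt`. Such objects lie in
`Ob(⊥J)`, every morphism of `⊥J` into `X` lifts through this deflation, and it splits when `X` is in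
`Ob(⊥J)`. -/

namespace ExactStructure

/-! ### Diagram lemmas in an exact category -/

section Basic

variable {C : Type u} [Category.{v} C] [Preadditive C]

/-- The deflations of an exact structure. -/
def deflation (E : ExactStructure C) : MorphismProperty C :=
  fun A _ p => ∃ (X : C) (i : X ⟶ A) (h : i ≫ p = 0), E.conflation (ShortComplex.mk i p h)

variable {E : ExactStructure C}

section

variable {A B X : C} {i : A ⟶ B} {p : B ⟶ X} {w : i ≫ p = 0}
  (h : E.conflation (ShortComplex.mk i p w))

include h

theorem inflation_of_conflation : E.inflation i := ⟨X, p, w, h⟩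

theorem deflation_of_conflation : E.deflation p := ⟨A, i, w, h⟩

theorem mono_of_conflation : Mono i :=
  mono_of_isLimit_fork (E.isKernel h).some

theorem epi_of_conflation : Epi p :=
  epi_of_isColimit_cofork (E.isCokernel h).some

theorem exists_desc_of_conflation {T : C} (k : B ⟶ T) (hk : i ≫ k = 0) :
    ∃ l : X ⟶ T, p ≫ l = k :=
  ⟨(E.isCokernel h).some.desc (CokernelCofork.ofπ k hk),
    (E.isCokernel h).some.fac (CokernelCofork.ofπ k hk) WalkingParallelPair.one⟩

theorem exists_lift_of_conflation {T : C} (k : T ⟶ B) (hk : k ≫ p = 0) :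
    ∃ l : T ⟶ A, l ≫ i = k :=
  ⟨(E.isKernel h).some.lift (KernelFork.ofι k hk),
    (E.isKernel h).some.fac (KernelFork.ofι k hk) WalkingParallelPair.zero⟩

end

theorem conflation_congr {A B X A' B' X' : C} {i : A ⟶ B} {p : B ⟶ X} {w : i ≫ p = 0}
    (h : E.conflation (ShortComplex.mk i p w)) {i' : A' ⟶ B'} {p' : B' ⟶ X'} {w' : i' ≫ p' = 0}
    (e₁ : A ≅ A') (e₂ : B ≅ B') (e₃ : X ≅ X') (h₁ : e₁.hom ≫ i' = i ≫ e₂.hom)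
    (h₂ : e₂.hom ≫ p' = p ≫ e₃.hom) : E.conflation (ShortComplex.mk i' p' w') :=
  E.conflation_of_iso (ShortComplex.isoMk e₁ e₂ e₃ h₁ h₂) h

/-- Cokernels are unique up to isomorphism, so `p` only has to be compared with the deflation that
`i` already has. Existence of factorizations plus `Epi p` is a convenient form of the cokernel
property. -/
theorem conflation_of_inflation {A B X : C} {i : A ⟶ B} {p : B ⟶ X} (hi : E.inflation i)
    (w : i ≫ p = 0) (hp : Epi p)
    (hd : ∀ (T : C) (k : B ⟶ T), i ≫ k = 0 → ∃ l : X ⟶ T, p ≫ l = k) :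
    E.conflation (ShortComplex.mk i p w) := by
  obtain ⟨Y, q, w', h⟩ := hi
  obtain ⟨a, ha⟩ := exists_desc_of_conflation h p w
  obtain ⟨b, hb⟩ := hd Y q w'
  have := epi_of_conflation h
  refine conflation_congr h (Iso.refl _) (Iso.refl _) ⟨a, b, ?_, ?_⟩ ?_ ?_
  · rw [← cancel_epi q, reassoc_of% ha, hb, Category.comp_id]
  · rw [← cancel_epi p, reassoc_of% hb, ha, Category.comp_id]
  · simp
  · simp [ha]

theorem conflation_of_deflation {A B X : C} {i : A ⟶ B} {p : B ⟶ X} (hp : E.deflation p)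
    (w : i ≫ p = 0) (hi : Mono i)
    (hl : ∀ (T : C) (k : T ⟶ B), k ≫ p = 0 → ∃ l : T ⟶ A, l ≫ i = k) :
    E.conflation (ShortComplex.mk i p w) := by
  obtain ⟨Y, j, w', h⟩ := hp
  obtain ⟨a, ha⟩ := exists_lift_of_conflation h i w
  obtain ⟨b, hb⟩ := hl Y j w'
  have := mono_of_conflation h
  refine conflation_congr h ⟨b, a, ?_, ?_⟩ (Iso.refl _) (Iso.refl _) ?_ ?_
  · rw [← cancel_mono j, Category.assoc, ha, hb, Category.id_comp]
  · rw [← cancel_mono i, Category.assoc, hb, ha, Category.id_comp]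
  · simp [hb]
  · simp

theorem inflation_comp {A B D : C} {i : A ⟶ B} {j : B ⟶ D} (hi : E.inflation i)
    (hj : E.inflation j) : E.inflation (i ≫ j) :=
  E.comp_inflation i j hi hj

theorem deflation_comp {A B D : C} {p : A ⟶ B} {q : B ⟶ D} (hp : E.deflation p)
    (hq : E.deflation q) : E.deflation (p ≫ q) := by
  obtain ⟨X, i, h, hc⟩ := E.comp_deflation p q hp hq
  exact ⟨X, i, h, hc⟩

theorem inflation_of_isIso {A B : C} (i : A ⟶ B) [IsIso i] : E.inflation i := by
  obtain ⟨X, p, h, hc⟩ := E.id_inflation A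
  refine ⟨X, inv i ≫ p, by simpa using h, 
    conflation_congr hc (Iso.refl _) (asIso i) (Iso.refl _) ?_ ?_⟩ <;> simp

theorem inflation_of_isPushout {A B A' B' : C} {i : A ⟶ B} {f : A ⟶ A'} {f' : B ⟶ B'}
    {i' : A' ⟶ B'} (hi : E.inflation i) (sq : IsPushout i f f' i') : E.inflation i' := by
  obtain ⟨B₁, f₁, i₁, sq₁, h₁⟩ := E.pushout_inflation i f hi
  have h₂ : E.inflation i₁ := h₁
  have : i' = i₁ ≫ (sq₁.isoIsPushout _ _ sq).hom := by simp
  rw [this]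
  exact inflation_comp h₂ (inflation_of_isIso _)

theorem conflation_of_isPushout {A B A' B' X : C} {i : A ⟶ B} {p : B ⟶ X} {w : i ≫ p = 0}
    (h : E.conflation (ShortComplex.mk i p w)) {f : A ⟶ A'} {f' : B ⟶ B'} {i' : A' ⟶ B'}
    (sq : IsPushout i f f' i') {p' : B' ⟶ X} (hp : f' ≫ p' = p) (w' : i' ≫ p' = 0) :
    E.conflation (ShortComplex.mk i' p' w') := by
  have := epi_of_conflation h
  have : Epi (f' ≫ p') := by rw [hp]; infer_instance
  refine conflation_of_inflation (inflation_of_isPushout ⟨X, p, w, h⟩ sq) w'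
    (epi_of_epi f' p') fun T k hk => ?_
  obtain ⟨l, hl⟩ := exists_desc_of_conflation h (f' ≫ k)
    (by rw [reassoc_of% sq.w, hk, comp_zero])
  refine ⟨l, sq.hom_ext ?_ ?_⟩
  · rw [reassoc_of% hp, hl]
  · rw [reassoc_of% w', hk, zero_comp]

theorem deflation_of_isPullback {B D D' B' : C} {p : B ⟶ D} {f : D' ⟶ D} {f' : B' ⟶ B}
    {p' : B' ⟶ D'} (hp : E.deflation p) (sq : IsPullback f' p' p f) : E.deflation p' := by
  obtain ⟨B₁, f₁, p₁, sq₁, X, i, w, h⟩ := E.pullback_deflation p f hp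
  let e := sq.isoIsPullback _ _ sq₁
  have he : e.hom ≫ p₁ = p' := by simp [e]
  refine ⟨X, i ≫ e.inv, by rw [← he]; simp [w], 
    conflation_congr h (Iso.refl _) e.symm (Iso.refl _) ?_ ?_⟩
  · simp
  · simp [← he]

theorem conflation_of_isPullback {A B X Y P : C} {i : A ⟶ B} {p : B ⟶ X} {w : i ≫ p = 0}
    (h : E.conflation (ShortComplex.mk i p w)) {m : Y ⟶ X} {b : P ⟶ B} {p' : P ⟶ Y}
    (sq : IsPullback b p' p m) {i' : A ⟶ P} (hi : i' ≫ b = i) (w' : i' ≫ p' = 0) :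
    E.conflation (ShortComplex.mk i' p' w') := by
  have := mono_of_conflation h
  have : Mono (i' ≫ b) := by rw [hi]; infer_instance
  refine conflation_of_deflation (deflation_of_isPullback ⟨A, i, w, h⟩ sq) w'
    (mono_of_mono i' b) fun T k hk => ?_
  obtain ⟨l, hl⟩ := exists_lift_of_conflation h (k ≫ b)
    (by rw [Category.assoc, sq.w, reassoc_of% hk, zero_comp])
  refine ⟨l, sq.hom_ext ?_ ?_⟩
  · rw [Category.assoc, hi, hl]
  · rw [Category.assoc, w', hk, comp_zero]

/-- The pullback of an inflation along a deflation is an inflation with the same cokernel. -/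
theorem conflation_of_isPullback_inflation {B X Y W P : C} {p : B ⟶ X} (hp : E.deflation p)
    {k : Y ⟶ X} {q : X ⟶ W} {w : k ≫ q = 0} (h : E.conflation (ShortComplex.mk k q w))
    {b : P ⟶ B} {p' : P ⟶ Y} (sq : IsPullback b p' p k) (w' : b ≫ p ≫ q = 0) :
    E.conflation (ShortComplex.mk b (p ≫ q) w') := by
  have := mono_of_conflation h
  refine conflation_of_deflation (deflation_comp hp ⟨Y, k, w, h⟩) w' ⟨fun s t hst => ?_⟩
    fun T t ht => ?_
  · refine sq.hom_ext hst ?_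
    rw [← cancel_mono k, Category.assoc, Category.assoc, ← sq.w, reassoc_of% hst]
  · obtain ⟨l, hl⟩ := exists_lift_of_conflation h (t ≫ p) (by simpa using ht)
    exact ⟨sq.lift t l hl.symm, sq.lift_fst _ _ _⟩

theorem Extension.exists_isPushoutAlong {X A A' : C} (ξ : E.Extension X A) (f : A ⟶ A') :
    ∃ ζ : E.Extension X A', ξ.IsPushoutAlong f ζ := by
  obtain ⟨B', f', i', sq, -⟩ := E.pushout_inflation ξ.i f ⟨_, _, _, ξ.conflation⟩
  have hw : ξ.i ≫ ξ.p = f ≫ 0 := by simp [ξ.zero]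
  exact ⟨⟨B', i', sq.desc ξ.p 0 hw, sq.inr_desc _ _ _,
    conflation_of_isPushout ξ.conflation sq (sq.inl_desc _ _ hw) _⟩, f', sq, sq.inl_desc _ _ hw⟩

theorem Extension.exists_isPullbackAlong {X Y A : C} (ξ : E.Extension X A) (m : Y ⟶ X) :
    ∃ η : E.Extension Y A, ξ.IsPullbackAlong m η := by
  obtain ⟨B', f', p', sq, -⟩ := E.pullback_deflation ξ.p m ⟨_, _, _, ξ.conflation⟩
  have hw : ξ.i ≫ ξ.p = 0 ≫ m := by simp [ξ.zero]
  exact ⟨⟨B', sq.lift ξ.i 0 hw, p', sq.lift_snd _ _ _,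
    conflation_of_isPullback ξ.conflation sq (sq.lift_fst _ _ hw) _⟩, f', sq, sq.lift_fst _ _ hw⟩

theorem Extension.isTrivial_iff_exists_section {X A : C} (ξ : E.Extension X A) :
    ξ.IsTrivial ↔ ∃ s : X ⟶ ξ.mid, s ≫ ξ.p = 𝟙 X := by
  have := mono_of_conflation ξ.conflation
  have := epi_of_conflation ξ.conflation
  constructor
  · rintro ⟨r, hr⟩
    obtain ⟨s, hs⟩ := exists_desc_of_conflation ξ.conflation (𝟙 _ - r ≫ ξ.i)
      (by simp [reassoc_of% hr])
    refine ⟨s, ?_⟩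
    rw [← cancel_epi ξ.p, reassoc_of% hs]
    simp [ξ.zero]
  · rintro ⟨s, hs⟩
    obtain ⟨r, hr⟩ := exists_lift_of_conflation ξ.conflation (𝟙 _ - ξ.p ≫ s)
      (by simp [hs])
    refine ⟨r, ?_⟩
    rw [← cancel_mono ξ.i, Category.assoc, hr]
    simp [reassoc_of% ξ.zero]

/-- The short five lemma with identities at the ends. -/
theorem isIso_of_conflations {A B B' X : C} {i : A ⟶ B} {p : B ⟶ X} {w : i ≫ p = 0}
    (h : E.conflation (ShortComplex.mk i p w)) {i' : A ⟶ B'} {p' : B' ⟶ X} {w' : i' ≫ p' = 0}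
    (h' : E.conflation (ShortComplex.mk i' p' w')) {b : B ⟶ B'} (hb : i ≫ b = i')
    (hb' : b ≫ p' = p) : IsIso b := by
  have := mono_of_conflation h'
  have hmono : Mono b := by
    rw [Preadditive.mono_iff_cancel_zero]
    intro T x hx
    obtain ⟨y, rfl⟩ := exists_lift_of_conflation h x (by rw [← hb', reassoc_of% hx, zero_comp])
    rw [Category.assoc, hb] at hx
    rw [Preadditive.mono_iff_cancel_zero] at this
    rw [this _ y hx, zero_comp]
  -- A right inverse of the mono `b` is enough. On the pullback of both deflations, `q ≫ b` and
  -- `η.p` agree up to a morphism `t` into `A`, and `t` retracts `η.i`; a section of `η.p` corrected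
  -- to kill `t` then gives the inverse.
  let ξ : E.Extension X A := ⟨B, i, p, w, h⟩
  obtain ⟨η, q, sq, hq⟩ := ξ.exists_isPullbackAlong p'
  obtain ⟨t, ht⟩ := exists_lift_of_conflation h' (q ≫ b - η.p)
    (by rw [Preadditive.sub_comp, Category.assoc, hb', sq.w, sub_self])
  have hti : η.i ≫ t = 𝟙 A := by
    have hq' : η.i ≫ q = i := hq
    rw [← cancel_mono i', Category.assoc, ht, Preadditive.comp_sub, reassoc_of% hq', hb, η.zero]
    simp
  obtain ⟨s, hs⟩ := η.isTrivial_iff_exists_section.1 ⟨t, hti⟩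
  let s' : B' ⟶ η.mid := s - s ≫ t ≫ η.i
  have hs' : s' ≫ η.p = 𝟙 B' := by simp [s', hs, η.zero]
  have hst : s' ≫ t = 0 := by simp [s', hti]
  have hu : (s' ≫ q) ≫ b = 𝟙 B' := by
    have h1 : s' ≫ (q ≫ b - η.p) = 0 := by rw [← ht, reassoc_of% hst, zero_comp]
    rw [Preadditive.comp_sub, hs', sub_eq_zero] at h1
    rw [Category.assoc, h1]
  exact ⟨s' ≫ q, by rw [← cancel_mono b, Category.assoc, hu]; simp, hu⟩

/-- Noether's isomorphism: the morphism induced on cokernels by an inflation. -/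
theorem conflation_of_cokernels {A X Y W W' Q : C} {a : A ⟶ X} {q : X ⟶ W} {w : a ≫ q = 0}
    (h : E.conflation (ShortComplex.mk a q w)) {x : X ⟶ Y} {c : Y ⟶ Q} {wx : x ≫ c = 0}
    (hx : E.conflation (ShortComplex.mk x c wx)) {a' : A ⟶ Y} (ha' : a ≫ x = a') {q' : Y ⟶ W'}
    {w' : a' ≫ q' = 0} (h' : E.conflation (ShortComplex.mk a' q' w')) {y : W ⟶ W'}
    (hy : q ≫ y = x ≫ q') :
    ∃ (d : W' ⟶ Q) (wd : y ≫ d = 0), E.conflation (ShortComplex.mk y d wd) := by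
  subst ha'
  have := epi_of_conflation h
  have := epi_of_conflation h'
  obtain ⟨d, hd⟩ := exists_desc_of_conflation h' c (by simp [wx])
  -- The square of `x` and `y` is a pushout, since maps out of `W'` are the maps out of `Y`
  -- vanishing on `A`; so `y` inherits the cokernel of `x`.
  have sq : IsPushout x q q' y := by
    refine ⟨⟨hy.symm⟩, ⟨PushoutCocone.IsColimit.mk _
      (fun s => (exists_desc_of_conflation h' s.inl
        (by rw [Category.assoc, s.condition, reassoc_of% w, zero_comp])).choose)
      (fun s => (exists_desc_of_conflation h' s.inl
        (by rw [Category.assoc, s.condition, reassoc_of% w, zero_comp])).choose_spec)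
      (fun s => ?_) (fun s m hm _ => ?_)⟩⟩
    · have := (exists_desc_of_conflation h' s.inl
        (by rw [Category.assoc, s.condition, reassoc_of% w, zero_comp])).choose_spec
      rw [← cancel_epi q, reassoc_of% hy, this, s.condition]
    · rw [← cancel_epi q', hm]
      exact ((exists_desc_of_conflation h' s.inl
        (by rw [Category.assoc, s.condition, reassoc_of% w, zero_comp])).choose_spec).symm
  have wd : y ≫ d = 0 := by
    rw [← cancel_epi q, reassoc_of% hy, hd, wx, comp_zero]
  exact ⟨d, wd, conflation_of_isPushout hx sq hd wd⟩

end Basic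

/-! ### Direct sums of conflations -/

section Biprod

variable {C : Type u} [Category.{v} C] [Preadditive C] [HasFiniteBiproducts C]
  {E : ExactStructure C}

theorem inflation_biprod_map_id {A B : C} {i : A ⟶ B} (hi : E.inflation i) (Z : C) :
    E.inflation (biprod.map i (𝟙 Z)) := by
  refine inflation_of_isPushout (f := biprod.inl) (f' := biprod.inl) hi ⟨⟨by simp⟩,
    ⟨PushoutCocone.IsColimit.mk _ (fun s => biprod.desc s.inl (biprod.inr ≫ s.inr))
      (fun s => by simp) (fun s => ?_) (fun s m h₁ h₂ => ?_)⟩⟩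
  · ext
    · simp [s.condition]
    · simp
  · ext
    · simp [h₁]
    · simp [← h₂]

theorem inflation_biprod_map {A B A' B' : C} {i : A ⟶ B} {i' : A' ⟶ B'} (hi : E.inflation i)
    (hi' : E.inflation i') : E.inflation (biprod.map i i') := by
  have h : biprod.map i i' = biprod.map i (𝟙 _) ≫ (biprod.braiding _ _).hom ≫
      biprod.map i' (𝟙 _) ≫ (biprod.braiding _ _).hom := by
    ext <;> simp
  rw [h]
  exact inflation_comp (inflation_biprod_map_id hi _) (inflation_comp (inflation_of_isIso _)
    (inflation_comp (inflation_biprod_map_id hi' _) (inflation_of_isIso _)))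

theorem conflation_biprod_map {A B X A' B' X' : C} {i : A ⟶ B} {p : B ⟶ X} {w : i ≫ p = 0}
    (h : E.conflation (ShortComplex.mk i p w)) {i' : A' ⟶ B'} {p' : B' ⟶ X'} {w' : i' ≫ p' = 0}
    (h' : E.conflation (ShortComplex.mk i' p' w')) :
    E.conflation (ShortComplex.mk (biprod.map i i') (biprod.map p p')
      (by ext <;> simp [reassoc_of% w, reassoc_of% w'])) := by
  have := epi_of_conflation h
  have := epi_of_conflation h'
  refine conflation_of_inflation (inflation_biprod_map (inflation_of_conflation h)
    (inflation_of_conflation h')) _ ⟨fun s t hst => ?_⟩ fun T k hk => ?_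
  · ext
    · rw [← cancel_epi p]
      simpa using biprod.inl ≫= hst
    · rw [← cancel_epi p']
      simpa using biprod.inr ≫= hst
  · obtain ⟨l, hl⟩ := exists_desc_of_conflation h (biprod.inl ≫ k)
      (by simpa using biprod.inl ≫= hk)
    obtain ⟨l', hl'⟩ := exists_desc_of_conflation h' (biprod.inr ≫ k)
      (by simpa using biprod.inr ≫= hk)
    exact ⟨biprod.desc l l', by ext <;> simp [hl, hl']⟩

end Biprod

end ExactStructure

/-! ### Ideals and their objects -/

section Ideals

variable {C : Type u} [Category.{v} C] [Preadditive C]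

namespace IsMorphismIdeal

variable {I : MorphismProperty C} (hI : IsMorphismIdeal I)

include hI

theorem add_mem {X Y : C} {f g : X ⟶ Y} (hf : I f) (hg : I g) : I (f + g) := by
  have := hI.sub_mem f (0 - g) hf (hI.sub_mem 0 g (hI.zero_mem X Y) hg)
  simpa using this

theorem sum_mem {ι : Type*} (s : Finset ι) {X Y : C} {f : ι → (X ⟶ Y)} (hf : ∀ i ∈ s, I (f i)) :
    I (∑ i ∈ s, f i) :=
  Finset.sum_induction f (fun g => I g) (fun _ _ => hI.add_mem) (hI.zero_mem X Y) hf

theorem precomp_mem {X Y Z : C} (f : X ⟶ Y) {g : Y ⟶ Z} (hg : I g) : I (f ≫ g) := by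
  simpa using hI.comp_mem f g (𝟙 Z) hg

theorem postcomp_mem {X Y Z : C} {f : X ⟶ Y} (hf : I f) (g : Y ⟶ Z) : I (f ≫ g) := by
  simpa using hI.comp_mem (𝟙 X) f g hf

theorem mem_of_factorsThroughOb {X Y : C} {f : X ⟶ Y} (hf : factorsThroughOb (idealOb I) f) :
    I f := by
  obtain ⟨Z, g, h, hZ, rfl⟩ := hf
  have hZ' : I (𝟙 Z) := hZ
  simpa using hI.comp_mem g (𝟙 Z) h hZ'

theorem idealOb_of_retract {X Y : C} (s : X ⟶ Y) (r : Y ⟶ X) (h : s ≫ r = 𝟙 X)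
    (hY : idealOb I Y) : idealOb I X := by
  have hY' : I (𝟙 Y) := hY
  have := hI.comp_mem s (𝟙 Y) r hY'
  rw [Category.id_comp, h] at this
  exact this

theorem addClass_le_idealOb [HasFiniteBiproducts C] {P : ObjectProperty C} (hP : P ≤ idealOb I) :
    addClass P ≤ idealOb I := by
  rintro X ⟨n, f, Z, hf, ⟨e⟩⟩
  refine hI.idealOb_of_retract (biprod.inl ≫ e.inv) (e.hom ≫ biprod.fst) (by simp) ?_
  change I (𝟙 (⨁ f))
  rw [← biproduct.total]
  refine hI.sum_mem _ fun j _ => ?_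
  have hj : I (𝟙 (f j)) := hP _ (hf j)
  simpa using hI.comp_mem (biproduct.π f j) _ (biproduct.ι f j) hj

end IsMorphismIdeal

theorem isMorphismIdeal_inductivePower (W : MorphismProperty C) (o : Ordinal.{w}) :
    IsMorphismIdeal (inductivePower W o) where
  zero_mem X Y := fun _ hI _ => hI.zero_mem X Y
  sub_mem f g hf hg := fun I hI h => hI.sub_mem f g (hf I hI h) (hg I hI h)
  comp_mem f g k hg := fun I hI h => hI.comp_mem f g k (hg I hI h)

theorem transfiniteComposition_le_inductivePower (W : MorphismProperty C) (o : Ordinal.{w}) :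
    transfiniteComposition W o ≤ inductivePower W o :=
  fun _ _ f hf _ _ h => h f hf

end Ideals

namespace ExactStructure

/-! ### Orthogonality with respect to Ext -/

section Perp

variable {C : Type u} [Category.{v} C] [Preadditive C] {E : ExactStructure C}

/-- By the universal property of the pushout, retractions of the pushed-out inflation correspond to
extensions of `f`. This form is suited to varying `f`; `extMapZero_iff_lift` is the dual form,
suited to varying `m`. -/
theorem extMapZero_iff_extend {X Y A A' : C} {m : Y ⟶ X} {f : A ⟶ A'} :
    E.ExtMapZero m f ↔ ∀ (ξ : E.Extension X A) (η : E.Extension Y A),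
      ξ.IsPullbackAlong m η → ∃ h : η.mid ⟶ A', η.i ≫ h = f := by
  constructor
  · intro h ξ η hη
    obtain ⟨ζ, hζ⟩ := η.exists_isPushoutAlong f
    obtain ⟨r, hr⟩ := h ξ η ζ hη hζ
    obtain ⟨b, sq, -⟩ := hζ
    exact ⟨b ≫ r, by rw [reassoc_of% sq.w, hr, Category.comp_id]⟩
  · rintro h ξ η ζ hη ⟨b, sq, -⟩
    obtain ⟨k, hk⟩ := h ξ η hη
    exact ⟨sq.desc k (𝟙 _) (by simpa using hk), sq.inr_desc _ _ _⟩

theorem extMapZero_iff_lift {X Y A A' : C} {m : Y ⟶ X} {f : A ⟶ A'} :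
    E.ExtMapZero m f ↔ ∀ (ξ : E.Extension X A) (ζ : E.Extension X A'),
      ξ.IsPushoutAlong f ζ → ∃ s : Y ⟶ ζ.mid, s ≫ ζ.p = m := by
  rw [extMapZero_iff_extend]
  constructor
  · rintro h ξ ζ ⟨b, sq, hb⟩
    obtain ⟨η, hη⟩ := ξ.exists_isPullbackAlong m
    obtain ⟨k, hk⟩ := h ξ η hη
    obtain ⟨c, sq', hc⟩ := hη
    have := epi_of_conflation η.conflation
    -- Both terms restrict to `f ≫ ζ.i` on `A`, so their difference descends to `Y`; composing with
    -- `ζ.p` kills the second term.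
    obtain ⟨s, hs⟩ := exists_desc_of_conflation η.conflation (c ≫ b - k ≫ ζ.i) (by
      rw [Preadditive.comp_sub, reassoc_of% hc, reassoc_of% hk, sq.w, sub_self])
    refine ⟨s, ?_⟩
    rw [← cancel_epi η.p, reassoc_of% hs, Preadditive.sub_comp, Category.assoc, hb, sq'.w,
      Category.assoc, ζ.zero, comp_zero, sub_zero]
  · rintro h ξ η ⟨c, sq', hc⟩
    obtain ⟨ζ, hζ⟩ := ξ.exists_isPushoutAlong f
    obtain ⟨s, hs⟩ := h ξ ζ hζ
    obtain ⟨b, sq, hb⟩ := hζ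
    have := mono_of_conflation ζ.conflation
    obtain ⟨k, hk⟩ := exists_lift_of_conflation ζ.conflation (c ≫ b - η.p ≫ s) (by
      rw [Preadditive.sub_comp, Category.assoc, hb, sq'.w, Category.assoc, hs, sub_self])
    refine ⟨k, ?_⟩
    rw [← cancel_mono ζ.i, Category.assoc, hk, Preadditive.comp_sub, reassoc_of% hc, sq.w,
      reassoc_of% η.zero, zero_comp, sub_zero]

theorem extObjMapZero_iff {X A A' : C} {f : A ⟶ A'} :
    E.ExtObjMapZero X f ↔ ∀ ξ : E.Extension X A, ∃ h : ξ.mid ⟶ A', ξ.i ≫ h = f := by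
  constructor
  · intro h ξ
    obtain ⟨ζ, hζ⟩ := ξ.exists_isPushoutAlong f
    obtain ⟨r, hr⟩ := h ξ ζ hζ
    obtain ⟨b, sq, -⟩ := hζ
    exact ⟨b ≫ r, by rw [reassoc_of% sq.w, hr, Category.comp_id]⟩
  · rintro h ξ ζ ⟨b, sq, -⟩
    obtain ⟨k, hk⟩ := h ξ
    exact ⟨sq.desc k (𝟙 _) (by simpa using hk), sq.inr_desc _ _ _⟩

theorem extMapZero_id_iff {X A A' : C} {f : A ⟶ A'} :
    E.ExtMapZero (𝟙 X) f ↔ E.ExtObjMapZero X f := by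
  rw [extObjMapZero_iff, extMapZero_iff_extend]
  constructor
  · exact fun h ξ => h ξ ξ ⟨𝟙 _, IsPullback.of_horiz_isIso ⟨by simp⟩, by simp⟩
  · rintro h ξ η ⟨c, -, hc⟩
    obtain ⟨k, hk⟩ := h ξ
    exact ⟨c ≫ k, by rw [reassoc_of% hc, hk]⟩

theorem idealOb_leftPerp_iff {M : MorphismProperty C} {X : C} :
    idealOb (E.leftPerp M) X ↔ ∀ ⦃A A' : C⦄ (f : A ⟶ A'), M f → E.ExtObjMapZero X f := by
  simp only [idealOb, leftPerp, extMapZero_id_iff]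

theorem isMorphismIdeal_leftPerp (M : MorphismProperty C) : IsMorphismIdeal (E.leftPerp M) where
  zero_mem X Y := fun A A' f _ => extMapZero_iff_lift.2 fun _ _ _ => ⟨0, zero_comp⟩
  sub_mem m m' hm hm' := fun A A' f hf => extMapZero_iff_lift.2 fun ξ ζ hζ => by
    obtain ⟨s, hs⟩ := extMapZero_iff_lift.1 (hm f hf) ξ ζ hζ
    obtain ⟨s', hs'⟩ := extMapZero_iff_lift.1 (hm' f hf) ξ ζ hζ
    exact ⟨s - s', by rw [Preadditive.sub_comp, hs, hs']⟩
  comp_mem k m l hm := fun A A' f hf => extMapZero_iff_lift.2 fun ξ ζ ⟨b, sq, hb⟩ => by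
    obtain ⟨η, c, sq', hc⟩ := ξ.exists_isPullbackAlong l
    obtain ⟨ζ', hζ'⟩ := η.exists_isPushoutAlong f
    obtain ⟨s, hs⟩ := extMapZero_iff_lift.1 (hm f hf) η ζ' hζ'
    obtain ⟨b', sq'', hb'⟩ := hζ'
    have hw : η.i ≫ c ≫ b = f ≫ ζ.i := by rw [reassoc_of% hc, sq.w]
    -- Pulling back along `l` and pushing out along `f` commute up to this comparison map, which
    -- carries lifts of `m` to lifts of `m ≫ l`.
    have hd : sq''.desc (c ≫ b) ζ.i hw ≫ ζ.p = ζ'.p ≫ l := by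
      refine sq''.hom_ext ?_ ?_
      · rw [sq''.inl_desc_assoc, Category.assoc, hb, sq'.w, reassoc_of% hb']
      · rw [sq''.inr_desc_assoc, ζ.zero, reassoc_of% ζ'.zero, zero_comp]
    exact ⟨k ≫ s ≫ sq''.desc (c ≫ b) ζ.i hw, by simp [hd, reassoc_of% hs]⟩

theorem isMorphismIdeal_rightPerp (M : MorphismProperty C) : IsMorphismIdeal (E.rightPerp M) where
  zero_mem X Y := fun A A' f _ => extMapZero_iff_extend.2 fun _ _ _ => ⟨0, comp_zero⟩
  sub_mem f f' hf hf' := fun Y X m hm => extMapZero_iff_extend.2 fun ξ η hη => by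
    obtain ⟨s, hs⟩ := extMapZero_iff_extend.1 (hf m hm) ξ η hη
    obtain ⟨s', hs'⟩ := extMapZero_iff_extend.1 (hf' m hm) ξ η hη
    exact ⟨s - s', by rw [Preadditive.comp_sub, hs, hs']⟩
  comp_mem k f l hf := fun Y X m hm => extMapZero_iff_extend.2 fun ξ η ⟨c, sq, hc⟩ => by
    obtain ⟨ζ, b, sq', hb⟩ := ξ.exists_isPushoutAlong k
    obtain ⟨η', hη'⟩ := ζ.exists_isPullbackAlong m
    obtain ⟨s, hs⟩ := extMapZero_iff_extend.1 (hf m hm) ζ η' hη'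
    obtain ⟨c', sq'', hc'⟩ := hη'
    have hw : (c ≫ b) ≫ ζ.p = η.p ≫ m := by rw [Category.assoc, hb, sq.w]
    have hd : η.i ≫ sq''.lift (c ≫ b) η.p hw = k ≫ η'.i := by
      refine sq''.hom_ext ?_ ?_
      · rw [Category.assoc, sq''.lift_fst, reassoc_of% hc, sq'.w, Category.assoc, hc']
      · rw [Category.assoc, sq''.lift_snd, η.zero, Category.assoc, η'.zero, comp_zero]
    exact ⟨sq''.lift (c ≫ b) η.p hw ≫ s ≫ l, by rw [reassoc_of% hd, reassoc_of% hs]⟩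

/-- The right orthogonal of the single morphism `m` is an ideal, so it contains the ideal generated
by the compositions once it contains the compositions. -/
theorem leftPerp_inductivePower_of_transfiniteComposition {W : MorphismProperty C}
    {o : Ordinal.{w}} {Y X : C} {m : Y ⟶ X}
    (h : ∀ ⦃A A' : C⦄ (f : A ⟶ A'), transfiniteComposition W o f → E.ExtMapZero m f) :
    E.leftPerp (inductivePower W o) m := by
  intro A A' f hf
  have := hf _ (E.isMorphismIdeal_rightPerp (MorphismProperty.ofHoms fun _ : Unit => m))
    (fun A A' f hf Y' X' m' hm' => by
      obtain ⟨⟨⟩⟩ := hm'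
      exact h f hf)
  exact this m ⟨()⟩

/-- Objects of `S` and their coproducts have vanishing `Ext(-, f)` for `S`-ghosts `f`. -/
theorem extObjMapZero_of_sumClass {S : Set C} {X : C} (hX : sumClass S X) {A A' : C} {f : A ⟶ A'}
    (hf : E.ghost S f) : E.ExtObjMapZero X f := by
  obtain ⟨ι, x, inj, hS, ⟨hc⟩⟩ := hX
  rw [← extMapZero_id_iff, extMapZero_iff_lift]
  intro ξ ζ hζ
  have (i : ι) : ∃ s : x i ⟶ ζ.mid, s ≫ ζ.p = inj i := by
    have h := extMapZero_id_iff.2 (hf (x i) (hS i))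
    have h' : E.leftPerp (MorphismProperty.ofHoms fun _ : Unit => f) (inj i) := by
      have := (E.isMorphismIdeal_leftPerp _).postcomp_mem (I := E.leftPerp
        (MorphismProperty.ofHoms fun _ : Unit => f)) (f := 𝟙 (x i)) (by
          rintro _ _ _ ⟨⟩
          exact h) (inj i)
      simpa using this
    exact extMapZero_iff_lift.1 (h' f ⟨()⟩) ξ ζ hζ
  choose s hs using this
  refine ⟨hc.desc (Cofan.mk _ s), hc.hom_ext fun ⟨i⟩ => ?_⟩
  have := hc.fac (Cofan.mk _ s) ⟨i⟩
  rw [reassoc_of% this]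
  simpa using hs i

/-- An extension of an object of `⊥M` by a projective object is an object of `⊥M`. -/
theorem star_projectives_le {M : MorphismProperty C} (hM : IsMorphismIdeal M)
    {P : ObjectProperty C} (hP : P ≤ idealOb (E.leftPerp M)) :
    E.star E.projectives P ≤ idealOb (E.leftPerp M) := by
  rintro Q ⟨B, D, k, q, w, hB, hD, hc⟩
  rw [idealOb_leftPerp_iff]
  intro A A' f hf
  rw [extObjMapZero_iff]
  intro ξ
  obtain ⟨η, c, sq, hη⟩ := ξ.exists_isPullbackAlong k
  obtain ⟨r, hr⟩ := hB A η
  have hz : c ≫ ξ.p ≫ q = 0 := by rw [reassoc_of% sq.w, w, comp_zero]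
  -- Projectivity of `B` gives the retraction `r` of the part over `B`. What remains is to extend `r
  -- ≫ f`, still in `M`, along a conflation ending in `D`.
  let ξ' : E.Extension D η.mid := ⟨ξ.mid, c, ξ.p ≫ q, hz,
    conflation_of_isPullback_inflation (deflation_of_conflation ξ.conflation) hc sq hz⟩
  obtain ⟨h, hh⟩ := extObjMapZero_iff.1
    (idealOb_leftPerp_iff.1 (hP D hD) (r ≫ f) (hM.precomp_mem r hf)) ξ'
  refine ⟨h, ?_⟩
  change c ≫ h = r ≫ f at hh
  rw [← hη, Category.assoc, hh, reassoc_of% hr]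

end Perp

/-! ### Salce's argument -/

section Salce

variable {C : Type u} [Category.{v} C] [Preadditive C] {E : ExactStructure C}
  {M : MorphismProperty C} {P : ObjectProperty C}

/-- The pushout of `K ⟶ P ⟶ X` along a cosyzygy inflation `K ⟶ B` is read in both directions: one
side is a conflation onto `X`, the other shows the middle term as an extension of the cosyzygy by
`P`. -/
theorem exists_isPushoutAlong_star_projectives (hE : E.EnoughProjectives)
    (hc : ∀ A : C, ∃ (W : C) (ξ : E.Extension W A), M ξ.i ∧ P W) (X : C) :
    ∃ (A A' : C) (j : A ⟶ A') (ξ : E.Extension X A) (η : E.Extension X A'),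
      M j ∧ ξ.IsPushoutAlong j η ∧ E.star E.projectives P η.mid := by
  obtain ⟨K, ξ, hξ⟩ := hE X
  obtain ⟨W, ζ, hζ, hW⟩ := hc K
  obtain ⟨η, hη⟩ := ξ.exists_isPushoutAlong ζ.i
  refine ⟨K, ζ.mid, ζ.i, ξ, η, hζ, hη, ?_⟩
  obtain ⟨b, sq, hb⟩ := hη
  have hw : ζ.i ≫ ζ.p = ξ.i ≫ 0 := by simp [ζ.zero]
  exact ⟨ξ.mid, W, b, sq.flip.desc ζ.p 0 hw, sq.flip.inr_desc _ _ _, hξ, hW,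
    conflation_of_isPushout ζ.conflation sq.flip (sq.flip.inl_desc _ _ _) _⟩

/-- Anything right orthogonal to the cosyzygy of its source extends along the cosyzygy inflation,
hence factors through a morphism of `M`. -/
theorem rightPerp_leftPerp_eq (hM : IsMorphismIdeal M) (hP : P ≤ idealOb (E.leftPerp M))
    (hc : ∀ A : C, ∃ (W : C) (ξ : E.Extension W A), M ξ.i ∧ P W) :
    E.rightPerp (E.leftPerp M) = M := by
  ext A A' f
  refine ⟨fun hf => ?_, fun hf Y X m hm => hm f hf⟩
  obtain ⟨W, ξ, hξ, hW⟩ := hc A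
  obtain ⟨h, rfl⟩ := extObjMapZero_iff.1 (extMapZero_id_iff.1 (hf (𝟙 W) (hP W hW))) ξ
  exact hM.postcomp_mem hξ h

theorem isCompleteIdealCotorsionPair_leftPerp (hM : IsMorphismIdeal M)
    (hP : P ≤ idealOb (E.leftPerp M))
    (hc : ∀ A : C, ∃ (W : C) (ξ : E.Extension W A), M ξ.i ∧ P W) (hE : E.EnoughProjectives) :
    E.IsCompleteIdealCotorsionPair (E.leftPerp M) M where
  isIdealCotorsionPair := ⟨E.isMorphismIdeal_leftPerp M, hM, rightPerp_leftPerp_eq hM hP hc, rfl⟩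
  isSpecialPrecovering X := by
    obtain ⟨A, A', j, ξ, η, hj, hη, hs⟩ := exists_isPushoutAlong_star_projectives hE hc X
    refine ⟨A, A', j, ξ, η, by rwa [rightPerp_leftPerp_eq hM hP hc], hη, ?_⟩
    have hs' : E.leftPerp M (𝟙 η.mid) := star_projectives_le hM hP _ hs
    simpa using (E.isMorphismIdeal_leftPerp M).postcomp_mem hs' η.p
  isSpecialPreenveloping A := by
    obtain ⟨W, ξ, hξ, hW⟩ := hc A
    exact ⟨W, W, 𝟙 W, ξ, ξ, hP W hW, ⟨𝟙 _, IsPullback.of_horiz_isIso ⟨by simp⟩, by simp⟩, hξ⟩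

theorem isObjectIdeal_leftPerp (hM : IsMorphismIdeal M) (hP : P ≤ idealOb (E.leftPerp M))
    (hc : ∀ A : C, ∃ (W : C) (ξ : E.Extension W A), M ξ.i ∧ P W) (hE : E.EnoughProjectives) :
    IsObjectIdeal (E.leftPerp M) := by
  refine ⟨E.isMorphismIdeal_leftPerp M, ?_⟩
  ext Y X m
  refine ⟨fun hm => ?_, fun hm => (E.isMorphismIdeal_leftPerp M).mem_of_factorsThroughOb hm⟩
  obtain ⟨A, A', j, ξ, η, hj, hη, hs⟩ := exists_isPushoutAlong_star_projectives hE hc X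
  obtain ⟨s, hs'⟩ := extMapZero_iff_lift.1 (hm j hj) ξ η hη
  exact ⟨η.mid, s, η.p, star_projectives_le hM hP _ hs, hs'⟩

theorem idealOb_leftPerp_eq_addClass [HasFiniteBiproducts C] (hM : IsMorphismIdeal M)
    (hP : P ≤ idealOb (E.leftPerp M))
    (hc : ∀ A : C, ∃ (W : C) (ξ : E.Extension W A), M ξ.i ∧ P W) (hE : E.EnoughProjectives) :
    idealOb (E.leftPerp M) = addClass (E.star E.projectives P) := by
  refine le_antisymm (fun X hX => ?_)
    ((E.isMorphismIdeal_leftPerp M).addClass_le_idealOb (star_projectives_le hM hP))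
  obtain ⟨A, A', j, ξ, η, hj, hη, hs⟩ := exists_isPushoutAlong_star_projectives hE hc X
  obtain ⟨r, hr⟩ := idealOb_leftPerp_iff.1 hX j hj ξ η hη
  obtain ⟨s, hsp⟩ := η.isTrivial_iff_exists_section.1 ⟨r, hr⟩
  have := mono_of_conflation η.conflation
  obtain ⟨t, ht⟩ := exists_lift_of_conflation η.conflation (𝟙 _ - η.p ≫ s) (by simp [hsp])
  have hit : η.i ≫ t = 𝟙 _ := by
    rw [← cancel_mono η.i, Category.assoc, ht]
    simp [reassoc_of% η.zero]
  have hst : s ≫ t = 0 := by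
    rw [← cancel_mono η.i, Category.assoc, ht]
    simp [reassoc_of% hsp]
  -- One summand suffices: the conflation onto `X` splits, so `X` is a summand of its middle term.
  refine ⟨1, fun _ => η.mid, A', fun _ => hs, ⟨biproductUniqueIso _ ≪≫
    { hom := biprod.lift η.p t
      inv := biprod.desc s η.i
      hom_inv_id := by simp [biprod.lift_desc, ht]
      inv_hom_id := by ext <;> simp [hsp, hst, hit, η.zero] }⟩⟩

end Salce

end ExactStructure

/-! ### Transfinite recursion and initial segments -/

section WellOrder

variable {C : Type u} [Category.{v} C] {J : Type w} [LinearOrder J]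

/-- Construction of a natural transformation by transfinite recursion. -/
theorem exists_natTrans_of_step [WellFoundedLT J] [HasZeroMorphisms C] (B G : J ⥤ C)
    (Q : ∀ j, (B.obj j ⟶ G.obj j) → Prop)
    (step : ∀ (j : J) (x : ∀ i, i < j → (B.obj i ⟶ G.obj i)),
      (∀ i hi, Q i (x i hi)) →
      (∀ (i i' : J) (hii' : i ≤ i') (hi' : i' < j),
        B.map (homOfLE hii') ≫ x i' hi' = x i (hii'.trans_lt hi') ≫ G.map (homOfLE hii')) →
      ∃ y : B.obj j ⟶ G.obj j, Q j y ∧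
        ∀ i (hi : i < j), B.map (homOfLE hi.le) ≫ y = x i hi ≫ G.map (homOfLE hi.le)) :
    ∃ h : B ⟶ G, ∀ j, Q j (h.app j) := by
  classical
  choose y hQ hy using step
  let F : ∀ j, (∀ i, i < j → (B.obj i ⟶ G.obj i)) → (B.obj j ⟶ G.obj j) := fun j x =>
    if H : (∀ i hi, Q i (x i hi)) ∧ (∀ (i i' : J) (hii' : i ≤ i') (hi' : i' < j),
        B.map (homOfLE hii') ≫ x i' hi' = x i (hii'.trans_lt hi') ≫ G.map (homOfLE hii'))
    then y j x H.1 H.2 else 0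
  let h : ∀ j, B.obj j ⟶ G.obj j := (wellFounded_lt (α := J)).fix F
  have hfix : ∀ j, h j = F j (fun i _ => h i) := fun j => WellFounded.fix_eq _ _ _
  have key : ∀ j, Q j (h j) ∧
      ∀ i (hi : i ≤ j), B.map (homOfLE hi) ≫ h j = h i ≫ G.map (homOfLE hi) := by
    intro j
    induction j using (wellFounded_lt (α := J)).induction with
    | h j ih =>
      have H : (∀ i (_ : i < j), Q i (h i)) ∧ (∀ (i i' : J) (hii' : i ≤ i') (_ : i' < j),
          B.map (homOfLE hii') ≫ h i' = h i ≫ G.map (homOfLE hii')) :=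
        ⟨fun i hi => (ih i hi).1, fun i i' hii' hi' => (ih i' hi').2 i hii'⟩
      have hj : h j = y j (fun i _ => h i) H.1 H.2 := by
        rw [hfix]
        exact dif_pos H
      refine ⟨by rw [hj]; exact hQ _ _ _ _, fun i hi => ?_⟩
      rcases hi.eq_or_lt with rfl | hi'
      · simp
      · rw [hj]
        exact hy _ _ _ _ i hi'
  exact ⟨{ app := h, naturality := fun i j f => (key j).2 i (leOfHom f) }, fun j => (key j).1⟩

/-- The functor given by restriction to the elements `< j`. -/
abbrev restrictIio (F : J ⥤ C) (j : J) : Set.Iio j ⥤ C :=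
  (Set.principalSegIio j).monotone.functor ⋙ F

theorem covBy_coe_Iio {j : J} {α β : Set.Iio j} (h : α ⋖ β) : α.1 ⋖ β.1 :=
  ⟨h.lt, fun c hc hc' => h.2 (c := ⟨c, hc'.trans β.2⟩) hc hc'⟩

theorem successiveMapsIn_restrictIio {F : J ⥤ C} {W : MorphismProperty C}
    (hF : SuccessiveMapsIn F W) (j : J) : SuccessiveMapsIn (restrictIio F j) W :=
  fun α β h => hF α.1 β.1 (covBy_coe_Iio h)

theorem isSuccLimit_coe_Iio {j : J} {m : Set.Iio j} (hm : Order.IsSuccLimit m) :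
    Order.IsSuccLimit m.1 := by
  refine ⟨fun h => hm.1 fun a ha => h ha, fun a h => ?_⟩
  exact hm.2 ⟨a, h.lt.trans m.2⟩ ⟨h.lt, fun c hc hc' => h.2 hc hc'⟩

theorem isWellOrderContinuous_restrictIio (F : J ⥤ C) (j : J)
    (h : ∀ m, m < j → Order.IsSuccLimit m →
      Nonempty (IsColimit ((Set.principalSegIio m).cocone F))) :
    (restrictIio F j).IsWellOrderContinuous where
  nonempty_isColimit m hm := by
    obtain ⟨hc⟩ := h m.1 m.2 (isSuccLimit_coe_Iio hm)
    let e : Set.Iio m ≃o Set.Iio m.1 :=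
      { toFun := fun a => ⟨a.1.1, a.2⟩
        invFun := fun a => ⟨⟨a.1, a.2.trans m.2⟩, a.2⟩
        left_inv := fun _ => rfl
        right_inv := fun _ => rfl
        map_rel_iff' := Iff.rfl }
    exact ⟨hc.whiskerEquivalence e.equivalence⟩

end WellOrder

/-! ### Transfinite iteration with few colimits -/

section Iteration

variable {C : Type u} [Category.{v} C]

/-- The fully faithful embedding of a category into a cocomplete one that preserves all
colimits. -/
def coyonedaEmbedding (C : Type u) [Category.{v} C] :
    C ⥤ (C ⥤ Type (max w v))ᵒᵖ :=
  (uliftCoyoneda.{w} (C := C)).rightOp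

instance : (coyonedaEmbedding.{w} C).Full :=
  inferInstanceAs (uliftCoyoneda.{w} (C := C)).rightOp.Full

instance : (coyonedaEmbedding.{w} C).Faithful :=
  inferInstanceAs (uliftCoyoneda.{w} (C := C)).rightOp.Faithful

theorem preservesColimitsOfShape_coyonedaEmbedding {K : Type*} [Category K] :
    PreservesColimitsOfShape K (coyonedaEmbedding.{w} C) := by
  have : PreservesLimitsOfShape Kᵒᵖ (uliftCoyoneda.{w} (C := C)) :=
    preservesLimitsOfShape_of_evaluation _ _ fun X =>
      inferInstanceAs (PreservesLimitsOfShape Kᵒᵖ (yoneda.obj X ⋙ uliftFunctor.{w}))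
  exact preservesColimitsOfShape_rightOp K _

variable {D : Type*} [Category D] (Φ : C ⥤ D) [Φ.Full] [Φ.Faithful]

theorem isWellOrderContinuous_of_comp_fullyFaithful {K : Type*} [PartialOrder K] (F : K ⥤ C)
    [(F ⋙ Φ).IsWellOrderContinuous] : F.IsWellOrderContinuous where
  nonempty_isColimit m hm := by
    have h := (F ⋙ Φ).isColimitOfIsWellOrderContinuous m hm
    exact ⟨isColimitOfReflects Φ (IsColimit.ofIsoColimit h
      (Cocone.ext (Iso.refl _) fun _ => Category.comp_id _))⟩

theorem mem_of_arrow_iso_map {W : MorphismProperty C} [W.RespectsIso] {X Y X' Y' : C} {f : X ⟶ Y}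
    {g : X' ⟶ Y'} (hf : W f) (e : Arrow.mk (Φ.map f) ≅ Arrow.mk (Φ.map g)) : W g := by
  let l : Φ.obj X ≅ Φ.obj X' := Arrow.leftFunc.mapIso e
  let r : Φ.obj Y ≅ Φ.obj Y' := Arrow.rightFunc.mapIso e
  have h : l.hom ≫ Φ.map g = Φ.map f ≫ r.hom := e.hom.w
  exact (W.arrow_mk_iso_iff (Arrow.isoMk (Φ.preimageIso l) (Φ.preimageIso r)
    (Φ.map_injective (by simp [h])))).1 hf

theorem successiveMapsIn_of_iso_comp {W : MorphismProperty C} [W.RespectsIso] {K : Type*}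
    [Preorder K] {F : K ⥤ C} {G : K ⥤ D} (e : F ⋙ Φ ≅ G) (hG : SuccessiveMapsIn G (W.map Φ)) :
    SuccessiveMapsIn F W := by
  intro α β h
  obtain ⟨X, Y, f, hf, ⟨e'⟩⟩ := hG α β h
  exact mem_of_arrow_iso_map Φ hf
    (e' ≪≫ (Arrow.isoMk (e.app α) (e.app β) (e.hom.naturality (homOfLE h.le)).symm).symm)

/-- Existence of a transfinite iteration when only the colimits of the chains of morphisms in `W`
are known to exist. -/
theorem exists_transfinite_iteration (J : Type w) [LinearOrder J] [OrderBot J] [SuccOrder J]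
    [WellFoundedLT J] (W : MorphismProperty C) [W.RespectsIso]
    (hW : ∀ A : C, ∃ (B : C) (f : A ⟶ B), W f)
    (hcolim : ∀ j : J, Order.IsSuccLimit j → ∀ F : Set.Iio j ⥤ C, F.IsWellOrderContinuous →
      SuccessiveMapsIn F W → HasColimit F) (A : C) :
    ∃ G : J ⥤ C, G.IsWellOrderContinuous ∧ SuccessiveMapsIn G W ∧ Nonempty (A ≅ G.obj ⊥) := by
  classical
  choose T t ht using hW
  let Φ := coyonedaEmbedding.{w} C
  let Ψ : SmallObject.SuccStruct (C ⥤ Type (max w v))ᵒᵖ :=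
    -- A successor structure needs a value at every object. Off the essential image of `Φ` it is the
    -- identity, which is irrelevant since `hess` keeps the iteration in the image.
    { X₀ := Φ.obj A
      succ := fun X => if h : Φ.essImage X then Φ.obj (T h.witness) else X
      toSucc := fun X => if h : Φ.essImage X then
          h.getIso.inv ≫ Φ.map (t h.witness) ≫ eqToHom (by rw [dif_pos h])
        else eqToHom (by rw [dif_neg h]) }
  have hΨ : ∀ X, Φ.essImage X → W.map Φ (Ψ.toSucc X) ∧ Φ.essImage (Ψ.succ X) := by
    intro X h
    have h₁ : Ψ.succ X = Φ.obj (T h.witness) := dif_pos h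
    have h₂ : Ψ.toSucc X = h.getIso.inv ≫ Φ.map (t h.witness) ≫ eqToHom h₁.symm := dif_pos h
    refine ⟨?_, by rw [h₁]; exact Φ.obj_mem_essImage _⟩
    rw [h₂]
    exact ⟨_, _, t h.witness, ht _, ⟨Arrow.isoMk h.getIso (eqToIso h₁.symm) (by simp)⟩⟩
  let I := Ψ.iterationFunctor J
  have hsucc : ∀ j, ¬ IsMax j → Φ.essImage (I.obj j) →
      W.map Φ (I.map (homOfLE (Order.le_succ j))) ∧ Φ.essImage (I.obj (Order.succ j)) := by
    intro j hj h
    obtain ⟨h₁, h₂⟩ := hΨ _ h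
    refine ⟨?_, h₂.ofIso (Ψ.iterationFunctorObjSuccIso j hj).symm⟩
    have := Ψ.iterationFunctor_map_succ j hj
    change W.map Φ ((Ψ.iterationFunctor J).map _)
    rw [this]
    exact MorphismProperty.RespectsIso.postcomp _ _ _ h₁
  have hcov : ∀ α β (h : α ⋖ β), Φ.essImage (I.obj α) → W.map Φ (I.map (homOfLE h.le)) := by
    intro α β h hα
    obtain rfl := h.succ_eq
    exact (hsucc α h.lt.not_isMax hα).1
  have hess : ∀ j, Φ.essImage (I.obj j) := by
    intro j
    induction j using SuccOrder.limitRecOn with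
    | isMin j hj =>
      obtain rfl : j = ⊥ := by simpa using hj
      exact (Φ.obj_mem_essImage A).ofIso (Ψ.iterationFunctorObjBotIso J).symm
    | succ j hj ih => exact (hsucc j hj ih).2
    | isSuccLimit j hj ih =>
      -- The part below `j` lifts to a continuous chain of `W`-morphisms in `C`, whose colimit
      -- exists by `hcolim`; as `Φ` preserves it, the ambient colimit is again in the image.
      let H := Functor.essImage.liftFunctor (restrictIio I j) Φ fun k => ih k.1 k.2
      let e : H ⋙ Φ ≅ restrictIio I j := Functor.essImage.liftFunctorCompIso _ _ _
      have := isWellOrderContinuous_restrictIio I j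
        fun m _ hm => ⟨I.isColimitOfIsWellOrderContinuous m hm⟩
      have : (H ⋙ Φ).IsWellOrderContinuous := Functor.isWellOrderContinuous_of_iso e.symm
      have hH : SuccessiveMapsIn H W := successiveMapsIn_of_iso_comp Φ e fun α β h =>
        hcov _ _ (covBy_coe_Iio h) (ih _ α.2)
      have := hcolim j hj H (isWellOrderContinuous_of_comp_fullyFaithful Φ H) hH
      have := preservesColimitsOfShape_coyonedaEmbedding.{w} (C := C) (K := Set.Iio j)
      have h₁ := isColimitOfPreserves Φ (colimit.isColimit H)
      have h₂ := (IsColimit.precomposeHomEquiv e _).symm (I.isColimitOfIsWellOrderContinuous j hj)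
      exact ⟨colimit H, ⟨h₁.coconePointUniqueUpToIso h₂⟩⟩
  let H := Functor.essImage.liftFunctor I Φ hess
  let e : H ⋙ Φ ≅ I := Functor.essImage.liftFunctorCompIso _ _ _
  have : (H ⋙ Φ).IsWellOrderContinuous := Functor.isWellOrderContinuous_of_iso e.symm
  exact ⟨H, isWellOrderContinuous_of_comp_fullyFaithful Φ H,
    successiveMapsIn_of_iso_comp Φ e fun α β h => hcov _ _ h (hess α),
    ⟨Φ.preimageIso ((e.app ⊥) ≪≫ Ψ.iterationFunctorObjBotIso J).symm⟩⟩

end Iteration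

namespace ExactStructure

/-! ### Ghosts and the one-step construction -/

section Ghost

variable {C : Type u} [Category.{v} C] [Preadditive C] (E : ExactStructure C)

theorem ghost_eq_rightPerp (S : Set C) :
    E.ghost S = E.rightPerp (MorphismProperty.ofHoms fun X : S => 𝟙 (X : C)) := by
  ext A A' f
  constructor
  · rintro hf _ _ _ ⟨X⟩
    exact extMapZero_id_iff.2 (hf X.1 X.2)
  · intro hf X hX
    exact extMapZero_id_iff.1 (hf (𝟙 X) (MorphismProperty.ofHoms.mk (⟨X, hX⟩ : S)))

theorem isMorphismIdeal_ghost (S : Set C) : IsMorphismIdeal (E.ghost S) := by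
  rw [ghost_eq_rightPerp]
  exact E.isMorphismIdeal_rightPerp _

/-- The inflations with cokernel in `P`. -/
def inflationCokernelIn (P : ObjectProperty C) : MorphismProperty C :=
  fun _ B i => ∃ (Q : C) (p : B ⟶ Q) (h : i ≫ p = 0),
    P Q ∧ E.conflation (ShortComplex.mk i p h)

theorem inflationCokernelIn_le (P : ObjectProperty C) : E.inflationCokernelIn P ≤ E.inflation :=
  fun _ _ _ ⟨Q, p, h, _, hc⟩ => ⟨Q, p, h, hc⟩

instance (P : ObjectProperty C) : (E.inflationCokernelIn P).RespectsIso := by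
  refine MorphismProperty.RespectsIso.mk _ ?_ ?_
  · rintro X Y Z e f ⟨Q, p, h, hQ, hc⟩
    exact ⟨Q, p, by simp [h], hQ,
      conflation_congr hc e.symm (Iso.refl _) (Iso.refl _) (by simp) (by simp)⟩
  · rintro X Y Z e f ⟨Q, p, h, hQ, hc⟩
    exact ⟨Q, e.inv ≫ p, by simp [h], hQ,
      conflation_congr hc (Iso.refl _) e (Iso.refl _) (by simp) (by simp)⟩

theorem _root_.IsMorphismIdeal.respectsIso {I : MorphismProperty C} (hI : IsMorphismIdeal I) :
    I.RespectsIso :=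
  MorphismProperty.RespectsIso.mk _ (fun e _ hf => hI.precomp_mem e.hom hf)
    (fun e _ hf => hI.postcomp_mem hf e.hom)

variable {E}

/-- Every object is the source of a ghost inflation with cokernel in `Sum(S)`: push out the
coproduct of all conflations ending in `S` along the codiagonal. -/
theorem exists_ghost_conflation (hExt : ∀ X A : C, Small.{v} (E.Ext X A)) (S : Set C)
    (hS : Small.{v} S) (hcoprod : E.HasExactCoproducts) (A : C) :
    ∃ (W : C) (ξ : E.Extension W A), E.ghost S ξ.i ∧ sumClass S W := by
  obtain ⟨_, hc⟩ := hcoprod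
  -- Only isomorphism classes of conflations are indexed: this is where smallness of `S` and of Ext
  -- makes the coproduct available.
  let κ := Σ X : S, E.Ext X A
  have : Small.{v} κ := small_sigma _
  let s : Shrink.{v} κ → κ := (equivShrink κ).symm
  let η (k : κ) : E.Extension k.1 A := k.2.out
  let ξ : E.Extension (∐ fun i => ((s i).1 : C)) (∐ fun _ : Shrink.{v} κ => A) :=
    ⟨∐ fun i => (η (s i)).mid, _, _, _, hc (Shrink.{v} κ)
      (fun i => ShortComplex.mk (η (s i)).i (η (s i)).p (η (s i)).zero)
      fun i => (η (s i)).conflation⟩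
  obtain ⟨ζ, b, sq, hb⟩ := ξ.exists_isPushoutAlong (Sigma.desc fun _ => 𝟙 A)
  have key (k : κ) : ∃ h : (η k).mid ⟶ ζ.mid, (η k).i ≫ h = ζ.i := by
    obtain ⟨i, rfl⟩ := (equivShrink κ).symm.surjective k
    refine ⟨Sigma.ι (fun i => (η (s i)).mid) i ≫ b, ?_⟩
    have h₁ : (η (s i)).i ≫ Sigma.ι (fun i => (η (s i)).mid) i =
        Sigma.ι (fun _ : Shrink.{v} κ => A) i ≫ ξ.i :=
      (Sigma.ι_map (fun i => (η (s i)).i) i).symm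
    change (η (s i)).i ≫ _ = _
    rw [reassoc_of% h₁, sq.w, Sigma.ι_desc_assoc, Category.id_comp]
  refine ⟨_, ζ, fun X hX => extObjMapZero_iff.2 fun θ => ?_, _, _, _, fun i => (s i).1.2,
    ⟨coproductIsCoproduct _⟩⟩
  -- The chosen representative of the class of `θ` occurs in the coproduct, and `ζ.i` extends along
  -- it; the isomorphism with `θ` transports the extension.
  obtain ⟨h, hh⟩ := key ⟨⟨X, hX⟩, Quotient.mk _ θ⟩
  obtain ⟨e, he, -⟩ : Extension.Equivalent (η ⟨⟨X, hX⟩, Quotient.mk _ θ⟩) θ :=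
    Quotient.mk_out (s := E.extensionSetoid X A) θ
  exact ⟨e.inv ≫ h, by rw [← he, Category.assoc, e.hom_inv_id_assoc, hh]⟩

end Ghost

/-! ### Closure properties of `Sum(S)` -/

section SumClass

variable {C : Type u} [Category.{v} C]

theorem sumClass_of_isZero (S : Set C) {Z : C} (hZ : IsZero Z) : sumClass S Z :=
  ⟨PEmpty, PEmpty.elim, fun i => i.elim, fun i => i.elim,
    ⟨Cofan.IsColimit.mk _ (fun _ => hZ.to_ _) (fun _ i => i.elim) fun _ _ _ => hZ.eq_of_src _ _⟩⟩

theorem sumClass_biprod [Preadditive C] [HasFiniteBiproducts C] {S : Set C} {X Y : C} (hX : sumClass S X)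
    (hY : sumClass S Y) : sumClass S (X ⊞ Y) := by
  obtain ⟨ι, f, a, hf, ⟨ha⟩⟩ := hX
  obtain ⟨κ, g, b, hg, ⟨hb⟩⟩ := hY
  refine ⟨ι ⊕ κ, Sum.elim f g,
    fun | .inl i => a i ≫ biprod.inl | .inr i => b i ≫ biprod.inr, ?_, ⟨?_⟩⟩
  · rintro (i | i)
    exacts [hf i, hg i]
  · refine Cofan.IsColimit.mk _ (fun s => biprod.desc
      (ha.desc (Cofan.mk _ fun i => s.inj (.inl i))) (hb.desc (Cofan.mk _ fun i => s.inj (.inr i))))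
      ?_ ?_
    · rintro s (i | i)
      · have h := ha.fac (Cofan.mk _ fun i => s.inj (.inl i)) ⟨i⟩
        change a i ≫ _ = s.inj (.inl i) at h
        change (a i ≫ biprod.inl) ≫ _ = _
        rw [Category.assoc, biprod.inl_desc, h]
      · have h := hb.fac (Cofan.mk _ fun i => s.inj (.inr i)) ⟨i⟩
        change b i ≫ _ = s.inj (.inr i) at h
        change (b i ≫ biprod.inr) ≫ _ = _
        rw [Category.assoc, biprod.inr_desc, h]
    · intro s m hm
      refine biprod.hom_ext' _ _ ?_ ?_
      · rw [biprod.inl_desc]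
        refine ha.hom_ext fun ⟨i⟩ => ?_
        rw [ha.fac]
        exact (Category.assoc _ _ _).symm.trans (hm (.inl i))
      · rw [biprod.inr_desc]
        refine hb.hom_ext fun ⟨i⟩ => ?_
        rw [hb.fac]
        exact (Category.assoc _ _ _).symm.trans (hm (.inr i))

end SumClass

end ExactStructure

/-! ### Elementwise colimits of chains -/

section ChainColimit

variable {C : Type u} [Category.{v} C] {J : Type w} [LinearOrder J]

theorem SuccessiveMapsIn.mono {K : Type*} [Preorder K] {F : K ⥤ C}
    {W W' : MorphismProperty C} (hF : SuccessiveMapsIn F W) (h : W ≤ W') :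
    SuccessiveMapsIn F W' :=
  fun α β hαβ => h _ (hF α β hαβ)

/-- The morphisms `ι i` exhibit `Z` as the colimit of the `F.obj i` for `i < j`. -/
structure IsChainColimit (F : J ⥤ C) (j : J) {Z : C} (ι : ∀ i, i < j → (F.obj i ⟶ Z)) :
    Prop where
  w : ∀ (i i' : J) (h : i ≤ i') (hi' : i' < j),
    F.map (homOfLE h) ≫ ι i' hi' = ι i (h.trans_lt hi')
  desc : ∀ {T : C} (x : ∀ i, i < j → (F.obj i ⟶ T)), (∀ (i i' : J) (h : i ≤ i') (hi' : i' < j),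
    F.map (homOfLE h) ≫ x i' hi' = x i (h.trans_lt hi')) →
      ∃ y : Z ⟶ T, ∀ i hi, ι i hi ≫ y = x i hi
  hom_ext : ∀ {T : C} {s t : Z ⟶ T}, (∀ i hi, ι i hi ≫ s = ι i hi ≫ t) → s = t

theorem isChainColimit_of_isColimit {F : J ⥤ C} {j : J} {c : Cocone (restrictIio F j)}
    (hc : IsColimit c) : IsChainColimit F j fun i hi => c.ι.app ⟨i, hi⟩ where
  w i i' h hi' := c.w (homOfLE h : (⟨i, h.trans_lt hi'⟩ : Set.Iio j) ⟶ ⟨i', hi'⟩)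
  desc {T} x hx :=
    let s : Cocone (restrictIio F j) :=
      { pt := T
        ι := { app := fun a => x a.1 a.2
               naturality := fun a b f =>
                (hx a.1 b.1 (leOfHom f) b.2).trans (Category.comp_id _).symm } }
    ⟨hc.desc s, fun i hi => hc.fac s ⟨i, hi⟩⟩
  hom_ext h := hc.hom_ext fun a => h a.1 a.2

theorem IsChainColimit.nonempty_isColimit {F : J ⥤ C} {j : J}
    (h : IsChainColimit F j fun i (hi : i < j) => F.map (homOfLE hi.le)) :
    Nonempty (IsColimit ((Set.principalSegIio j).cocone F)) := by
  have (s : Cocone (restrictIio F j)) : ∃ y : F.obj j ⟶ s.pt,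
      ∀ i (hi : i < j), F.map (homOfLE hi.le) ≫ y = s.ι.app ⟨i, hi⟩ :=
    h.desc (fun i hi => s.ι.app ⟨i, hi⟩) fun i i' hii' hi' =>
      s.w (homOfLE hii' : (⟨i, hii'.trans_lt hi'⟩ : Set.Iio j) ⟶ ⟨i', hi'⟩)
  choose y hy using this
  exact ⟨{ desc := y
           fac := fun s a => hy s a.1 a.2
           uniq := fun s m hm => h.hom_ext fun i hi => (hm ⟨i, hi⟩).trans (hy s i hi).symm }⟩

theorem isChainColimit_of_isWellOrderContinuous (F : J ⥤ C) [F.IsWellOrderContinuous] {j : J}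
    (hj : Order.IsSuccLimit j) :
    IsChainColimit F j fun i (hi : i < j) => F.map (homOfLE hi.le) :=
  isChainColimit_of_isColimit (F.isColimitOfIsWellOrderContinuous j hj)

theorem IsChainColimit.exists_iso {F : J ⥤ C} {j : J} {Z Z' : C} {ι : ∀ i, i < j → (F.obj i ⟶ Z)}
    {ι' : ∀ i, i < j → (F.obj i ⟶ Z')} (h : IsChainColimit F j ι) (h' : IsChainColimit F j ι') :
    ∃ e : Z ≅ Z', ∀ i hi, ι i hi ≫ e.hom = ι' i hi := by
  obtain ⟨a, ha⟩ := h.desc ι' h'.w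
  obtain ⟨b, hb⟩ := h'.desc ι h.w
  exact ⟨⟨a, b, h.hom_ext fun i hi => by rw [reassoc_of% ha, hb, Category.comp_id],
    h'.hom_ext fun i hi => by rw [reassoc_of% hb, ha, Category.comp_id]⟩, ha⟩

theorem IsChainColimit.of_isIso {F : J ⥤ C} {j : J} {Z Z' : C}
    {ι : ∀ i, i < j → (F.obj i ⟶ Z)} {ι' : ∀ i, i < j → (F.obj i ⟶ Z')}
    (h : IsChainColimit F j ι) (u : Z ⟶ Z') [IsIso u] (hu : ∀ i hi, ι i hi ≫ u = ι' i hi) :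
    IsChainColimit F j ι' where
  w i i' hii' hi' := by rw [← hu, ← hu, reassoc_of% h.w]
  desc x hx := by
    obtain ⟨y, hy⟩ := h.desc x hx
    exact ⟨inv u ≫ y, fun i hi => by rw [← hu, Category.assoc, IsIso.hom_inv_id_assoc, hy]⟩
  hom_ext {T s t} hst := by
    rw [← cancel_epi u]
    exact h.hom_ext fun i hi => by rw [reassoc_of% hu, reassoc_of% hu, hst]

end ChainColimit

namespace ExactStructure

/-! ### Chains of inflations and Eklof's lemma -/

section Chains

variable {C : Type u} [Category.{v} C] [Preadditive C] {E : ExactStructure C}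
  {J : Type w} [LinearOrder J]

/-- The proper initial segments of limit length of `J` index continuous chains of inflations that
have a colimit, with composition an inflation. -/
def ChainsCompose (E : ExactStructure C) (J : Type w) [LinearOrder J] [OrderBot J] : Prop :=
  ∀ (j : J) (hj : Order.IsSuccLimit j) (F : Set.Iio j ⥤ C), F.IsWellOrderContinuous →
    SuccessiveMapsIn F E.inflation →
      ∃ c : Cocone F, Nonempty (IsColimit c) ∧ E.inflation (c.ι.app ⟨⊥, hj.bot_lt⟩)

theorem exists_isChainColimit [OrderBot J] (hJ : E.ChainsCompose J) {F : J ⥤ C} {j : J}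
    (hj : Order.IsSuccLimit j) (hcont : ∀ m, m < j → Order.IsSuccLimit m →
      Nonempty (IsColimit ((Set.principalSegIio m).cocone F)))
    (hF : SuccessiveMapsIn F E.inflation) :
    ∃ (Z : C) (ι : ∀ i, i < j → (F.obj i ⟶ Z)),
      IsChainColimit F j ι ∧ E.inflation (ι ⊥ hj.bot_lt) := by
  obtain ⟨c, ⟨hc⟩, hi⟩ := hJ j hj (restrictIio F j) (isWellOrderContinuous_restrictIio F j hcont)
    (successiveMapsIn_restrictIio hF j)
  exact ⟨c.pt, _, isChainColimit_of_isColimit hc, hi⟩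

/-- Successors use closure of inflations under composition. At limits `ChainsCompose` gives the
claim outright, after identifying its colimit with `F.obj j` by continuity. -/
theorem inflation_map_bot [OrderBot J] [WellFoundedLT J] (hJ : E.ChainsCompose J) {F : J ⥤ C} [F.IsWellOrderContinuous]
    (hF : SuccessiveMapsIn F E.inflation) (j : J) :
    E.inflation (F.map (homOfLE (bot_le : ⊥ ≤ j))) := by
  let _ : SuccOrder J := SuccOrder.ofLinearWellFoundedLT J
  induction j using SuccOrder.limitRecOn with
  | isMin j hj =>
    obtain rfl : j = ⊥ := by simpa using hj
    have : F.map (homOfLE (bot_le : (⊥ : J) ≤ ⊥)) = 𝟙 _ := F.map_id _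
    rw [this]
    exact inflation_of_isIso _
  | succ j hj ih =>
    have : F.map (homOfLE (bot_le : ⊥ ≤ Order.succ j)) =
        F.map (homOfLE bot_le) ≫ F.map (homOfLE (Order.le_succ j)) := by
      rw [← F.map_comp]
      rfl
    rw [this]
    exact inflation_comp ih (hF _ _ (Order.covBy_succ_of_not_isMax hj))
  | isSuccLimit j hj _ =>
    obtain ⟨Z, ι, hι, hi⟩ := exists_isChainColimit hJ hj
      (fun m _ hm => ⟨F.isColimitOfIsWellOrderContinuous m hm⟩) hF
    obtain ⟨e, he⟩ := hι.exists_iso (isChainColimit_of_isWellOrderContinuous F hj)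
    rw [← he ⊥ hj.bot_lt]
    exact inflation_comp hi (inflation_of_isIso _)

/-- A system of conflations `A ⟶ B j ⟶ F j` with constant kernel. -/
structure ExtensionSystem (E : ExactStructure C) (F : J ⥤ C) (A : C) where
  /-- the system of middle terms -/
  B : J ⥤ C
  /-- the inflations -/
  i : (Functor.const J).obj A ⟶ B
  /-- the deflations -/
  p : B ⟶ F
  zero : ∀ j, i.app j ≫ p.app j = 0
  conflation : ∀ j, E.conflation (ShortComplex.mk (i.app j) (p.app j) (zero j))

variable {F : J ⥤ C} {A : C}

/-- The pullbacks of a conflation along a cocone. -/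
theorem exists_extensionSystem {X : C} (φ : F ⟶ (Functor.const J).obj X) (ξ : E.Extension X A) :
    ∃ (T : E.ExtensionSystem F A) (b : T.B ⟶ (Functor.const J).obj ξ.mid),
      (∀ j, IsPullback (b.app j) (T.p.app j) ξ.p (φ.app j)) ∧
      ∀ j, T.i.app j ≫ b.app j = ξ.i := by
  choose η b sq hb using fun j => ξ.exists_isPullbackAlong (φ.app j)
  have hw {j k : J} (f : j ⟶ k) : b j ≫ ξ.p = ((η j).p ≫ F.map f) ≫ φ.app k := by
    have := φ.naturality f
    simp only [Functor.const_obj_obj, Functor.const_obj_map, Category.comp_id] at this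
    rw [Category.assoc, this, (sq j).w]
  let B : J ⥤ C :=
    { obj := fun j => (η j).mid
      map := fun {j k} f => (sq k).lift (b j) ((η j).p ≫ F.map f) (hw f)
      map_id := fun j => (sq j).hom_ext (by simp) (by simp)
      map_comp := fun {j k l} f g => (sq l).hom_ext (by simp) (by simp) }
  refine ⟨⟨B, { app := fun j => (η j).i, naturality := ?_ },
    { app := fun j => (η j).p, naturality := ?_ }, fun j => (η j).zero,
    fun j => (η j).conflation⟩, { app := b, naturality := ?_ }, sq, hb⟩
  · intro j k f
    refine (sq k).hom_ext ?_ ?_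
    · simp [B, hb]
    · simp [B, (η k).zero, reassoc_of% (η j).zero]
  · intro j k f
    simp [B]
  · intro j k f
    simp [B]

namespace ExtensionSystem

variable (T : E.ExtensionSystem F A)

/-- Both `T.B.obj j` and the pullback are extensions of `F.obj j` by `A`, so the short five lemma
identifies them. -/
theorem isPullback {j k : J} (f : j ⟶ k) :
    IsPullback (T.B.map f) (T.p.app j) (T.p.app k) (F.map f) := by
  have hk := mono_of_conflation (T.conflation k)
  have := epi_of_conflation (T.conflation j)
  have hi : T.i.app j ≫ T.B.map f = T.i.app k := by
    simpa using (T.i.naturality f).symm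
  let ξ : E.Extension (F.obj k) A := ⟨_, _, _, _, T.conflation k⟩
  obtain ⟨η, b, sq, hb⟩ := ξ.exists_isPullbackAlong (F.map f)
  let u : T.B.obj j ⟶ η.mid := sq.lift (T.B.map f) (T.p.app j) (T.p.naturality f)
  have hu₁ : u ≫ b = T.B.map f := sq.lift_fst _ _ _
  have hu₂ : u ≫ η.p = T.p.app j := sq.lift_snd _ _ _
  have : IsIso u := by
    refine isIso_of_conflations (T.conflation j) η.conflation (sq.hom_ext ?_ ?_) hu₂
    · rw [Category.assoc, hu₁, hi, hb]
    · rw [Category.assoc, hu₂, T.zero, η.zero]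
  exact sq.of_iso' (asIso u) (Iso.refl _) (Iso.refl _) (Iso.refl _) (by simp [hu₁, ξ])
    (by simp [hu₂]) (by simp [ξ]) (by simp)

theorem successiveMapsIn {P : ObjectProperty C}
    (hF : SuccessiveMapsIn F (E.inflationCokernelIn P)) :
    SuccessiveMapsIn T.B (E.inflationCokernelIn P) := by
  intro α β h
  obtain ⟨Q, q, w, hQ, hc⟩ := hF α β h
  have sq := T.isPullback (homOfLE h.le)
  have hz : T.B.map (homOfLE h.le) ≫ T.p.app β ≫ q = 0 := by
    rw [reassoc_of% sq.w, w, comp_zero]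
  exact ⟨Q, _, hz, hQ, conflation_of_isPullback_inflation
    (deflation_of_conflation (T.conflation β)) hc sq hz⟩

theorem i_map {j k : J} (h : j ≤ k) : T.i.app j ≫ T.B.map (homOfLE h) = T.i.app k := by
  simpa using (T.i.naturality (homOfLE h)).symm

theorem isIso_bot [OrderBot J] (hF₀ : IsZero (F.obj ⊥)) : IsIso (T.i.app ⊥) := by
  have := mono_of_conflation (T.conflation ⊥)
  obtain ⟨l, hl⟩ := exists_lift_of_conflation (T.conflation ⊥) (𝟙 _) (hF₀.eq_of_tgt _ _)
  exact ⟨l, by rw [← cancel_mono (T.i.app ⊥), Category.assoc, hl]; simp, hl⟩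

/-- Colimits commute with cokernels: the colimit `Z` of the earlier middle terms is again an
extension of `F.obj j` by `A`, since `A ⟶ Z` is an inflation, and the short five lemma compares it
with `T.B.obj j`. The induction is needed because `Z` exists only once the chain below `j` is known
to be continuous. -/
theorem isWellOrderContinuous [OrderBot J] [WellFoundedLT J] (hJ : E.ChainsCompose J) [F.IsWellOrderContinuous]
    (hF₀ : IsZero (F.obj ⊥)) (hF : SuccessiveMapsIn T.B E.inflation) :
    T.B.IsWellOrderContinuous := by
  refine ⟨fun j => ?_⟩
  induction j using (wellFounded_lt (α := J)).induction with
  | h j ih =>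
  intro hj
  have := T.isIso_bot hF₀
  obtain ⟨Z, ι, hι, hi⟩ := exists_isChainColimit hJ hj ih hF
  have hFj := isChainColimit_of_isWellOrderContinuous F hj
  obtain ⟨u, hu⟩ := hι.desc (fun i hi => T.B.map (homOfLE hi.le)) fun i i' h hi' => by
    rw [← T.B.map_comp]
    rfl
  have hp (a : J) (ha : a < j) : T.B.map (homOfLE ha.le) ≫ T.p.app j =
      T.p.app a ≫ F.map (homOfLE ha.le) := T.p.naturality _
  have hia (a : J) (ha : a < j) : T.i.app a ≫ ι a ha = T.i.app ⊥ ≫ ι ⊥ hj.bot_lt := by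
    rw [← hι.w ⊥ a bot_le ha, ← Category.assoc, T.i_map]
  have hw : (T.i.app ⊥ ≫ ι ⊥ hj.bot_lt) ≫ u ≫ T.p.app j = 0 := by
    rw [Category.assoc, reassoc_of% hu, ← Category.assoc, T.i_map, T.zero]
  have hconf : E.conflation (ShortComplex.mk (T.i.app ⊥ ≫ ι ⊥ hj.bot_lt) (u ≫ T.p.app j) hw) := by
    refine conflation_of_inflation (inflation_comp (inflation_of_isIso _) hi) hw
      ⟨fun s t hst => hFj.hom_ext fun a ha => ?_⟩ fun Y k hk => ?_
    · have := epi_of_conflation (T.conflation a)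
      rw [← cancel_epi (T.p.app a), ← reassoc_of% hp a ha, ← reassoc_of% hp a ha,
        ← reassoc_of% hu a ha, ← reassoc_of% hu a ha]
      simpa using ι a ha ≫= hst
    · have (a : J) (ha : a < j) : ∃ l : F.obj a ⟶ Y, T.p.app a ≫ l = ι a ha ≫ k :=
        exists_desc_of_conflation (T.conflation a) _ (by rw [← Category.assoc, hia, hk])
      choose l hl using this
      obtain ⟨y, hy⟩ := hFj.desc l fun a b hab hb => by
        have := epi_of_conflation (T.conflation a)
        rw [← cancel_epi (T.p.app a), ← T.p.naturality_assoc, hl, hl, reassoc_of% hι.w]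
      refine ⟨y, hι.hom_ext fun a ha => ?_⟩
      rw [Category.assoc, reassoc_of% hu, reassoc_of% hp a ha, hy, hl]
  have : IsIso u := isIso_of_conflations hconf (T.conflation j)
    (by rw [Category.assoc, hu, T.i_map]) rfl
  exact (hι.of_isIso u hu).nonempty_isColimit

/-- Extension of a morphism along a filtration whose quotients are left orthogonal to the
successive morphisms of the target system. -/
theorem exists_natTrans [OrderBot J] [WellFoundedLT J] {P : ObjectProperty C} {M : MorphismProperty C}
    (hPM : ∀ (Q X Y : C) (f : X ⟶ Y), P Q → M f → E.ExtObjMapZero Q f)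
    [T.B.IsWellOrderContinuous] (hB : SuccessiveMapsIn T.B (E.inflationCokernelIn P))
    (hF₀ : IsZero (F.obj ⊥)) {G : J ⥤ C} (hG : SuccessiveMapsIn G M) (γ : A ⟶ G.obj ⊥) :
    ∃ h : T.B ⟶ G, ∀ j, T.i.app j ≫ h.app j = γ ≫ G.map (homOfLE bot_le) := by
  let _ : SuccOrder J := SuccOrder.ofLinearWellFoundedLT J
  have := T.isIso_bot hF₀
  refine exists_natTrans_of_step T.B G
    (fun j y => T.i.app j ≫ y = γ ≫ G.map (homOfLE bot_le)) fun j x hx hxx => ?_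
  induction j using SuccOrder.limitRecOn with
  | isMin j hj =>
    obtain rfl : j = ⊥ := by simpa using hj
    refine ⟨inv (T.i.app ⊥) ≫ γ, ?_, fun i hi => (not_lt_bot hi).elim⟩
    have : G.map (homOfLE (bot_le : (⊥ : J) ≤ ⊥)) = 𝟙 _ := G.map_id _
    simp
  | succ j hj _ =>
    have hcov := Order.covBy_succ_of_not_isMax hj
    obtain ⟨Q, q, w, hQ, hc⟩ := hB j _ hcov
    let ξ : E.Extension Q (T.B.obj j) := ⟨_, _, _, _, hc⟩
    -- Pushing out along the map already built gives a conflation starting at `G.obj j` with end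
    -- `Q`; the next morphism of `G` is in `M`, so it extends over it.
    obtain ⟨ζ, b, sq, -⟩ := ξ.exists_isPushoutAlong (x j hcov.lt)
    obtain ⟨k, hk⟩ := extObjMapZero_iff.1 (hPM Q _ _ _ hQ (hG j _ hcov)) ζ
    have hbk : T.B.map (homOfLE hcov.le) ≫ b ≫ k =
        x j hcov.lt ≫ G.map (homOfLE hcov.le) := by
      have := sq.w
      change T.B.map (homOfLE hcov.le) ≫ b = _ at this
      rw [reassoc_of% this, hk]
    have hmap : ∀ i (hi : i < Order.succ j), T.B.map (homOfLE hi.le) ≫ b ≫ k =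
        x i hi ≫ G.map (homOfLE hi.le) := by
      intro i hi
      have hij : i ≤ j := (Order.lt_succ_iff_of_not_isMax hj).1 hi
      have h₁ : T.B.map (homOfLE hi.le) =
          T.B.map (homOfLE hij) ≫ T.B.map (homOfLE hcov.le) := by
        rw [← T.B.map_comp]
        rfl
      have h₂ : G.map (homOfLE hi.le) = G.map (homOfLE hij) ≫ G.map (homOfLE hcov.le) := by
        rw [← G.map_comp]
        rfl
      rw [h₁, h₂, Category.assoc, hbk, reassoc_of% hxx i j hij hcov.lt]
    refine ⟨b ≫ k, ?_, hmap⟩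
    rw [← T.i_map hcov.le, Category.assoc, hbk, reassoc_of% hx j hcov.lt, ← G.map_comp]
    rfl
  | isSuccLimit j hj _ =>
    obtain ⟨y, hy⟩ := (isChainColimit_of_isWellOrderContinuous T.B hj).desc
      (fun i hi => x i hi ≫ G.map (homOfLE hi.le)) fun i i' h hi' => by
        rw [reassoc_of% hxx i i' h hi', ← G.map_comp]
        rfl
    refine ⟨y, ?_, hy⟩
    rw [← T.i_map (bot_le (a := j)), Category.assoc, hy ⊥ hj.bot_lt, reassoc_of% hx,
      ← G.map_comp]
    rfl

end ExtensionSystem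

/-- Eklof's lemma for transfinite compositions. -/
theorem exists_extension_of_filtration [OrderBot J] [WellFoundedLT J] (hJ : E.ChainsCompose J) {P : ObjectProperty C}
    {M : MorphismProperty C}
    (hPM : ∀ (Q X Y : C) (f : X ⟶ Y), P Q → M f → E.ExtObjMapZero Q f)
    [F.IsWellOrderContinuous] (hF : SuccessiveMapsIn F (E.inflationCokernelIn P))
    (hF₀ : IsZero (F.obj ⊥)) {G : J ⥤ C} (hG : SuccessiveMapsIn G M) (γ : A ⟶ G.obj ⊥)
    {t : J} (ht : ∀ j, j ≤ t) (ξ : E.Extension (F.obj t) A) :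
    ∃ h : ξ.mid ⟶ G.obj t, ξ.i ≫ h = γ ≫ G.map (homOfLE bot_le) := by
  let φ : F ⟶ (Functor.const J).obj (F.obj t) :=
    { app := fun j => F.map (homOfLE (ht j))
      naturality := fun j k f => by
        dsimp
        rw [Category.comp_id, ← F.map_comp]
        rfl }
  obtain ⟨T, b, sq, hb⟩ := exists_extensionSystem φ ξ
  have hB := T.successiveMapsIn hF
  have := T.isWellOrderContinuous hJ hF₀ (hB.mono (E.inflationCokernelIn_le P))
  obtain ⟨h, hh⟩ := T.exists_natTrans hPM hB hF₀ hG γ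
  have h₁ : φ.app t = 𝟙 _ := F.map_id t
  have sqt := sq t
  rw [h₁] at sqt
  -- Since `t` is the top index, the pullback at `t` is along an identity and recovers `ξ`.
  have : IsIso (b.app t) := sqt.isIso_fst_of_isIso
  refine ⟨inv (b.app t) ≫ h.app t, ?_⟩
  rw [← hb t, Category.assoc, IsIso.hom_inv_id_assoc, hh]

/-- The quotients of a continuous chain of inflations by its first term. -/
theorem exists_quotient_system [OrderBot J] [WellFoundedLT J] (hJ : E.ChainsCompose J) {P : ObjectProperty C} {G : J ⥤ C}
    [G.IsWellOrderContinuous] (hG : SuccessiveMapsIn G (E.inflationCokernelIn P)) (t : J) :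
    ∃ (W : J ⥤ C) (q : G.obj t ⟶ W.obj t) (w : G.map (homOfLE (bot_le : ⊥ ≤ t)) ≫ q = 0),
      W.IsWellOrderContinuous ∧ IsZero (W.obj ⊥) ∧
      SuccessiveMapsIn W (E.inflationCokernelIn P) ∧
      E.conflation (ShortComplex.mk (G.map (homOfLE bot_le)) q w) := by
  choose W q w hc using inflation_map_bot hJ (hG.mono (E.inflationCokernelIn_le P))
  have hepi (j : J) : Epi (q j) := epi_of_conflation (hc j)
  have hbot {j k : J} (f : j ⟶ k) : G.map (homOfLE (bot_le : ⊥ ≤ j)) ≫ G.map f =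
      G.map (homOfLE bot_le) := by
    rw [← G.map_comp]
    rfl
  have hm {j k : J} (f : j ⟶ k) : ∃ l : W j ⟶ W k, q j ≫ l = G.map f ≫ q k :=
    exists_desc_of_conflation (hc j) _ (by rw [reassoc_of% hbot f, w])
  choose m hm using @hm
  let V : J ⥤ C :=
    { obj := W
      map := m
      map_id := fun j => by rw [← cancel_epi (q j), hm]; simp
      map_comp := fun f g => by
        rw [← cancel_epi (q _), hm, reassoc_of% hm f, hm, G.map_comp, Category.assoc] }
  -- The first quotient vanishes, so a compatible family out of the quotients restricts to zero on
  -- `G.obj ⊥`; hence colimits pass from `G` to the quotients.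
  have hq₀ : q ⊥ = 0 := by
    have h₁ := w ⊥
    have h₂ : G.map (homOfLE (bot_le : (⊥ : J) ≤ ⊥)) = 𝟙 _ := G.map_id _
    rwa [h₂, Category.id_comp] at h₁
  refine ⟨V, q t, w t, ⟨fun j hj => IsChainColimit.nonempty_isColimit ?_⟩, ?_, fun α β h => ?_,
    hc t⟩
  · have hGj := isChainColimit_of_isWellOrderContinuous G hj
    refine ⟨fun i i' h hi' => ?_, fun {T} x hx => ?_, fun {T s t} hst => ?_⟩
    · rw [← V.map_comp]
      rfl
    · have hx' (i i' : J) (h : i ≤ i') (hi' : i' < j) :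
          m (homOfLE h) ≫ x i' hi' = x i (h.trans_lt hi') := hx i i' h hi'
      obtain ⟨y, hy⟩ := hGj.desc (fun i hi => q i ≫ x i hi) fun i i' h hi' => by
        rw [← reassoc_of% hm, hx']
      obtain ⟨l, hl⟩ := exists_desc_of_conflation (hc j) y
        (by rw [hy ⊥ hj.bot_lt, hq₀, zero_comp])
      refine ⟨l, fun i hi => ?_⟩
      change m (homOfLE hi.le) ≫ l = _
      rw [← cancel_epi (q i), reassoc_of% hm, hl, hy]
    · change W j ⟶ T at s t
      rw [← cancel_epi (q j)]
      refine hGj.hom_ext fun i hi => ?_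
      rw [← reassoc_of% hm, ← reassoc_of% hm]
      exact congrArg (q i ≫ ·) (hst i hi)
  · rw [IsZero.iff_id_eq_zero]
    change 𝟙 (W ⊥) = 0
    rw [← cancel_epi (q ⊥), hq₀]
    simp
  · obtain ⟨Q, c, wc, hQ, hcc⟩ := hG α β h
    -- By Noether's isomorphism, dividing out the first term leaves the successive cokernels
    -- unchanged.
    obtain ⟨d, wd, hd⟩ := conflation_of_cokernels (hc α) hcc (hbot _) (hc β) (hm (homOfLE h.le))
    exact ⟨Q, d, wd, hQ, hd⟩

end Chains

end ExactStructure

namespace ExactStructure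

/-! ### The two main facts for systems indexed by ordinals -/

section Ordinals

variable {C : Type u} [Category.{v} C] [Preadditive C] {E : ExactStructure C} {o : Ordinal.{w}}

/-- The first index as the least element of the index set of an `(o + 1)`-system. -/
abbrev orderBotIicOrdinal (o : Ordinal.{w}) : OrderBot (Set.Iic o) where
  bot := firstIndex o
  bot_le _ := (zero_le : (0 : Ordinal.{w}) ≤ _)

attribute [local instance] orderBotIicOrdinal

/-- The indices below `j` are exactly the ordinals below `j`, and `j ≤ o`, so the hypothesis at `β =
j` applies after reindexing. The case `j = o` is included. -/
theorem chainsCompose_Iic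
    (hcomp : ∀ (β : Ordinal.{w}) (hβ : 0 < β), β ≤ o → E.InflationsCompose β hβ) :
    E.ChainsCompose (Set.Iic o) := by
  intro j hj F hF hF'
  let e : Set.Iio (j : Ordinal.{w}) ≃o Set.Iio j :=
    { toFun := fun a => ⟨⟨a.1, (Set.mem_Iio.1 a.2).le.trans j.2⟩, a.2⟩
      invFun := fun a => ⟨a.1.1, a.2⟩
      left_inv := fun _ => rfl
      right_inv := fun _ => rfl
      map_rel_iff' := Iff.rfl }
  have hj₀ : 0 < (j : Ordinal.{w}) := hj.bot_lt
  obtain ⟨c, ⟨hc⟩, hi⟩ := hcomp j.1 hj₀ j.2 (e.equivalence.functor ⋙ F) inferInstance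
    fun α β h => hF' (e α) (e β) ((apply_covBy_apply_iff e).2 h)
  let c' : Cocone F :=
    { pt := c.pt
      ι := { app := fun a => c.ι.app (e.symm a)
             naturality := fun a b f => c.ι.naturality (homOfLE (leOfHom f) :
              (e.symm a : Set.Iio (j : Ordinal.{w})) ⟶ e.symm b) } }
  refine ⟨c', ⟨?_⟩, hi⟩
  exact
    { desc := fun s => hc.desc (s.whisker e.equivalence.functor)
      fac := fun s a => hc.fac (s.whisker e.equivalence.functor) (e.symm a)
      uniq := fun s m hm => hc.uniq (s.whisker e.equivalence.functor) m fun a => hm (e a) }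

/-- Filtrations by coproducts of objects of `S` lie in `⊥(g_S^(o))`. -/
theorem filt_le_idealOb_leftPerp {S : Set C} (hJ : E.ChainsCompose (Set.Iic o)) :
    E.filt o (sumClass S) ≤ idealOb (E.leftPerp (inductivePower (E.ghost S) o)) := by
  rintro X ⟨F, hF, hF₀, ⟨e⟩, hFs⟩
  refine (E.isMorphismIdeal_leftPerp _).idealOb_of_retract e.inv e.hom e.inv_hom_id ?_
  refine leftPerp_inductivePower_of_transfiniteComposition fun A A' f hf => ?_
  rw [extMapZero_id_iff, extObjMapZero_iff]
  intro ξ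
  obtain ⟨G, e₀, e₁, hG, hGs, rfl⟩ := hf
  obtain ⟨h, hh⟩ := exists_extension_of_filtration hJ
    (fun Q X Y f hQ hf => extObjMapZero_of_sumClass hQ hf) hFs hF₀ hGs e₀.hom
    (t := lastIndex o) (fun j => j.2) ξ
  exact ⟨h ≫ e₁.hom, by rw [reassoc_of% hh]⟩

theorem exists_inductivePower_cosyzygy (hExt : ∀ X A : C, Small.{v} (E.Ext X A)) (S : Set C)
    (hS : Small.{v} S) (hcoprod : E.HasExactCoproducts) (hJ : E.ChainsCompose (Set.Iic o)) (A : C) :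
    ∃ (W : C) (ξ : E.Extension W A),
      inductivePower (E.ghost S) o ξ.i ∧ E.filt o (sumClass S) W := by
  let _ : SuccOrder (Set.Iic o) := SuccOrder.ofLinearWellFoundedLT _
  have := (E.isMorphismIdeal_ghost S).respectsIso
  -- Both properties must be iterated together: the ghost part puts the composition in the inductive
  -- power, and the cokernel part filters its cokernel.
  let M : MorphismProperty C := E.ghost S ⊓ E.inflationCokernelIn (sumClass S)
  obtain ⟨G, hG, hGs, ⟨e⟩⟩ := exists_transfinite_iteration (Set.Iic o) M
    (fun B => by
      obtain ⟨W, ξ, hξ, hW⟩ := exists_ghost_conflation hExt S hS hcoprod B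
      exact ⟨_, ξ.i, hξ, W, ξ.p, ξ.zero, hW, ξ.conflation⟩)
    (fun j hj F hF hF' => by
      obtain ⟨c, ⟨hc⟩, -⟩ := hJ j hj F hF
        (hF'.mono (inf_le_right.trans (E.inflationCokernelIn_le _)))
      exact ⟨⟨c, hc⟩⟩) A
  obtain ⟨V, q, w, hV, hV₀, hVs, hc⟩ := exists_quotient_system hJ
    (hGs.mono (inf_le_right : M ≤ E.inflationCokernelIn (sumClass S))) (lastIndex o)
  refine ⟨V.obj (lastIndex o), ⟨G.obj (lastIndex o), e.hom ≫ G.map (homOfLE bot_le), q,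
    by rw [Category.assoc, w, comp_zero],
    conflation_congr hc e.symm (Iso.refl _) (Iso.refl _) (by simp) (by simp)⟩, ?_,
    V, hV, hV₀, ⟨Iso.refl _⟩, hVs⟩
  exact transfiniteComposition_le_inductivePower _ _ _
    ⟨G, e, Iso.refl _, hG, hGs.mono inf_le_left, by simp⟩

end Ordinals

/-! ### Filtered objects are closed under finite direct sums -/

section FiltClosure

variable {C : Type u} [Category.{v} C] [Preadditive C] {E : ExactStructure C} {o : Ordinal.{w}}

theorem filt_of_isZero {P : ObjectProperty C} (hP : ∀ Z : C, IsZero Z → P Z) {Z : C}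
    (hZ : IsZero Z) : E.filt o P Z := by
  refine ⟨(Functor.const _).obj Z, ⟨fun m hm => IsChainColimit.nonempty_isColimit ?_⟩, hZ,
    ⟨Iso.refl _⟩, fun α β h => ⟨Z, 0, comp_zero, hP Z hZ, ?_⟩⟩
  · exact ⟨fun _ _ _ _ => hZ.eq_of_src _ _, fun _ _ => ⟨0, fun _ _ => hZ.eq_of_src _ _⟩,
      fun _ => hZ.eq_of_src _ _⟩
  · exact conflation_of_inflation (inflation_of_isIso (𝟙 Z)) _ ⟨fun _ _ _ => hZ.eq_of_src _ _⟩
      fun _ _ _ => ⟨0, hZ.eq_of_src _ _⟩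

/-- The two filtrations are added index by index. They have the same length, and biproducts respect
both conflations and chain colimits. -/
theorem filt_biprod [HasFiniteBiproducts C] {P : ObjectProperty C}
    (hP : ∀ X Y : C, P X → P Y → P (X ⊞ Y)) {X Y : C} (hX : E.filt o P X) (hY : E.filt o P Y) :
    E.filt o P (X ⊞ Y) := by
  obtain ⟨F, hF, hF₀, ⟨e⟩, hFs⟩ := hX
  obtain ⟨G, hG, hG₀, ⟨e'⟩, hGs⟩ := hY
  let H : Set.Iic o ⥤ C :=
    { obj := fun j => F.obj j ⊞ G.obj j
      map := fun f => biprod.map (F.map f) (G.map f)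
      map_id := fun j => by ext <;> simp
      map_comp := fun f g => by ext <;> simp }
  refine ⟨H, ⟨fun m hm => IsChainColimit.nonempty_isColimit ?_⟩, ?_, ⟨biprod.mapIso e e'⟩,
    fun α β h => ?_⟩
  · have hF' := isChainColimit_of_isWellOrderContinuous F hm
    have hG' := isChainColimit_of_isWellOrderContinuous G hm
    refine ⟨fun i i' h hi' => ?_, fun {T} x hx => ?_, fun {T s t} hst => ?_⟩
    · rw [← H.map_comp]
      rfl
    · have hx' (i i' : Set.Iic o) (h : i ≤ i') (hi' : i' < m) :
          biprod.map (F.map (homOfLE h)) (G.map (homOfLE h)) ≫ x i' hi' =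
            x i (h.trans_lt hi') := hx i i' h hi'
      obtain ⟨y, hy⟩ := hF'.desc (fun i hi => biprod.inl ≫ x i hi) fun i i' h hi' => by
        rw [← hx' i i' h hi', biprod.inl_map_assoc]
      obtain ⟨z, hz⟩ := hG'.desc (fun i hi => biprod.inr ≫ x i hi) fun i i' h hi' => by
        rw [← hx' i i' h hi', biprod.inr_map_assoc]
      refine ⟨biprod.desc y z, fun i hi => ?_⟩
      change biprod.map _ _ ≫ _ = _
      refine biprod.hom_ext' _ _ ?_ ?_
      · rw [biprod.inl_map_assoc, biprod.inl_desc, hy]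
      · rw [biprod.inr_map_assoc, biprod.inr_desc, hz]
    · change F.obj m ⊞ G.obj m ⟶ T at s t
      have hst' (i : Set.Iic o) (hi : i < m) :
        biprod.map (F.map (homOfLE hi.le)) (G.map (homOfLE hi.le)) ≫ s =
          biprod.map (F.map (homOfLE hi.le)) (G.map (homOfLE hi.le)) ≫ t := hst i hi
      refine biprod.hom_ext' _ _ (hF'.hom_ext fun i hi => ?_) (hG'.hom_ext fun i hi => ?_)
      · have h := biprod.inl ≫= hst' i hi
        rwa [biprod.inl_map_assoc, biprod.inl_map_assoc] at h
      · have h := biprod.inr ≫= hst' i hi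
        rwa [biprod.inr_map_assoc, biprod.inr_map_assoc] at h
  · rw [IsZero.iff_id_eq_zero]
    exact biprod.hom_ext' _ _ (hF₀.eq_of_src _ _) (hG₀.eq_of_src _ _)
  · obtain ⟨Q, p, w, hQ, hc⟩ := hFs α β h
    obtain ⟨Q', p', w', hQ', hc'⟩ := hGs α β h
    exact ⟨Q ⊞ Q', _, _, hP _ _ hQ hQ', conflation_biprod_map hc hc'⟩

end FiltClosure

end ExactStructure

theorem corollary6p3 {C : Type u} [Category.{v} C] [Preadditive C] [HasFiniteBiproducts C]
    (E : ExactStructure C) (hExt : ∀ X A : C, Small.{v} (E.Ext X A))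
    (S : Set C) (hS : Small.{v} S) (hcoprod : E.HasExactCoproducts)
    (o : Ordinal.{w}) (ho : Ordinal.omega0 ≤ o)
    (hcomp : ∀ (β : Ordinal.{w}) (hβ : 0 < β), β ≤ o → E.InflationsCompose β hβ) :
    E.IsObjectSpecialPreenveloping (inductivePower (E.ghost S) o) ∧
    E.IsCosyzygySubcategory (inductivePower (E.ghost S) o) (E.filt o (sumClass S)) ∧
    (E.EnoughProjectives →
      E.IsCompleteIdealCotorsionPair
        (E.leftPerp (inductivePower (E.ghost S) o)) (inductivePower (E.ghost S) o) ∧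
      IsObjectIdeal (E.leftPerp (inductivePower (E.ghost S) o)) ∧
      idealOb (E.leftPerp (inductivePower (E.ghost S) o)) =
        addClass (E.star E.projectives (E.filt o (sumClass S)))) := by
  have hJ := ExactStructure.chainsCompose_Iic hcomp
  have hM := isMorphismIdeal_inductivePower (E.ghost S) o
  have hP := ExactStructure.filt_le_idealOb_leftPerp (S := S) hJ
  have hc := ExactStructure.exists_inductivePower_cosyzygy hExt S hS hcoprod hJ
  refine ⟨⟨hM, fun A => ?_⟩, ⟨hP, fun Z hZ => ?_, fun X Y hX hY => ?_, hc⟩, fun hE => ⟨?_, ?_, ?_⟩⟩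
  · obtain ⟨W, ξ, hξ, hW⟩ := hc A
    exact ⟨W, ξ, hξ, hP W hW⟩
  · exact ExactStructure.filt_of_isZero (fun Z => ExactStructure.sumClass_of_isZero S) hZ
  · exact ExactStructure.filt_biprod (fun X Y => ExactStructure.sumClass_biprod) hX hY
  · exact ExactStructure.isCompleteIdealCotorsionPair_leftPerp hM hP hc hE
  · exact ExactStructure.isObjectIdeal_leftPerp hM hP hc hE
  · exact ExactStructure.idealOb_leftPerp_eq_addClass hM hP hc hE
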